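/- Let $L$ be a bounded lattice with $0\neq 1$ that is an $(\omega+1)$-lattice: every maximal chain of $L$ is finite or order isomorphic to $\mathbb N\cup\{\infty\}$. Let $\mathcal K^*(L)$ be the set of admissible sequences in $L$, i.e. of strictly increasing sequences $x:\ x_0<x_1<\cdots$ in $L$ that are either finite of even length $2\ell(x)$ (the empty sequence included) or infinite, of type $\omega$ (then $\ell(x)=\omega$). Put $x\sqsubseteq y$ if for each $i<\ell(x)$ there is $j<\ell(y)$ with $y_{2j}\le x_{2i}<x_{2i+1}\le y_{2j+1}$. If $x$ is finite, let $x^\perp$ be the strictly increasing sequence whose set of terms is the symmetric difference of the set of terms of $x$ and $\{0,1\}$; if $x$ is infinite, let $x^\perp$ be $x_1<x_2<\cdots$ when $x_0=0$, and $0<x_0<x_1<\cdots$ when $x_0\ne0$. Let $\mathcal K(L)\subseteq\mathcal K^*(L)$ be the set of finite admissible sequences, with the restrictions of $\sqsubseteq$ and $\perp$, and for $C\subseteq L$ let $\mathcal K^*(C)\subseteq\mathcal K^*(L)$ be the set of admissible sequences all of whose terms lie in $C$. An orthomodular lattice (OML) is a bounded lattice with an order-inverting, period-two operation $\perp$ such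 that $x^\perp$ is a complement of $x$, and such that $x\le y$ implies $x\vee(x^\perp\wedge y)=y$. It is completely hereditarily atomic if it is complete and each of its complete subalgebras (subalgebras closed under all joins and meets of the whole algebra) is atomic, i.e. has an atom below each of its nonzero elements. A block is a maximal Boolean subalgebra. **Theorem.** Let $L$ be as above. 1. $\mathcal K^*(L)$, with the order $\sqsubseteq$ and the operation $\perp$, is a completely hereditarily atomic OML, with least element the empty sequence and greatest element the sequence $0<1$. 2. $\mathcal K^*(L)$ is the MacNeille completion of $\mathcal K(L)$: there is an order isomorphism from the lattice of Dedekind cuts $(A,B)$ of $\mathcal K(L)$ (pairs such that $B$ is the set of upper bounds of $A$ and $A$ the set of lower bounds of $B$) onto $\mathcal K^*(L)$ that sends the principal cut of each $x\in\mathcal K(L)$ to $x$, and under which the orthocomplementation of $\mathcal K^*(L)$ corresponds to $(A,B)\mapsto(\{b^\perp:b\in B\},\{a^\perp:a\in A\})$. 3. The blocks of $\mathcal K^*(L)$ are exactly the sets $\mathcal K^*(C)$, where $C$ is a maximal chain of $L$. -/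

import Mathlib

universe u

/-! ### Ortholattices and orthomodular lattices -/

/-- An ortholattice: a bounded lattice with an order-inverting, period-two operation `ᶜ` such that
`aᶜ` is a complement of `a` for each `a`. -/
class Ortholattice (α : Type u) extends Lattice α, BoundedOrder α, Compl α where
  compl_le_compl_of_le : ∀ a b : α, a ≤ b → bᶜ ≤ aᶜ
  compl_compl_eq : ∀ a : α, aᶜᶜ = a
  inf_compl_eq : ∀ a : α, a ⊓ aᶜ = ⊥
  sup_compl_eq : ∀ a : α, a ⊔ aᶜ = ⊤

/-- An orthomodular lattice. -/
class OrthomodularLattice (α : Type u) extends Ortholattice α where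
  sup_compl_inf_eq_of_le : ∀ a b : α, a ≤ b → a ⊔ (aᶜ ⊓ b) = b

/-- `S` is (the carrier of) a subalgebra of an ortholattice. -/
structure IsOrthoSubalgebra {α : Type u} [Ortholattice α] (S : Set α) : Prop where
  bot_mem : ⊥ ∈ S
  top_mem : ⊤ ∈ S
  sup_mem : ∀ a ∈ S, ∀ b ∈ S, a ⊔ b ∈ S
  inf_mem : ∀ a ∈ S, ∀ b ∈ S, a ⊓ b ∈ S
  compl_mem : ∀ a ∈ S, aᶜ ∈ S

/-- A complete subalgebra: a subalgebra closed under all joins and meets as taken in the whole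
algebra. -/
structure IsCompleteOrthoSubalgebra {α : Type u} [Ortholattice α] (S : Set α) : Prop extends
    IsOrthoSubalgebra S where
  lub_mem : ∀ T ⊆ S, ∀ a : α, IsLUB T a → a ∈ S
  glb_mem : ∀ T ⊆ S, ∀ a : α, IsGLB T a → a ∈ S

/-- A subalgebra, with the order of the whole algebra, has a least element. -/
abbrev IsOrthoSubalgebra.orderBot {α : Type u} [Ortholattice α] {S : Set α}
    (hS : IsOrthoSubalgebra S) : OrderBot S where
  bot := ⟨⊥, hS.bot_mem⟩
  bot_le := fun x => (bot_le : (⊥ : α) ≤ x.1)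

/-- An orthomodular lattice is completely hereditarily atomic if it is complete and each of its
complete subalgebras is atomic. -/
def IsCompletelyHereditarilyAtomic (α : Type u) [OrthomodularLattice α] : Prop :=
  (∀ T : Set α, (∃ a, IsLUB T a) ∧ ∃ a, IsGLB T a) ∧
    ∀ (S : Set α) (hS : IsCompleteOrthoSubalgebra S),
      @IsAtomic S _ hS.toIsOrthoSubalgebra.orderBot

/-- A Boolean subalgebra of an ortholattice: a subalgebra that is distributive. -/
def IsBooleanOrthoSubalgebra {α : Type u} [Ortholattice α] (S : Set α) : Prop :=
  IsOrthoSubalgebra S ∧ ∀ a ∈ S, ∀ b ∈ S, ∀ c ∈ S, a ⊓ (b ⊔ c) = (a ⊓ b) ⊔ (a ⊓ c)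

/-- A block of an ortholattice: a maximal Boolean subalgebra. -/
def IsBlock {α : Type u} [Ortholattice α] (B : Set α) : Prop :=
  Maximal (fun S : Set α => IsBooleanOrthoSubalgebra S) B

/-! ### `(ω + 1)`-lattices and admissible sequences -/

/-- Every maximal chain of `L` is finite or is order isomorphic to `ℕ ∪ {∞}`. -/
def IsOmegaPlusOneLattice (L : Type u) [Lattice L] : Prop :=
  ∀ C : Set L, IsMaxChain (· ≤ ·) C → C.Finite ∨ Nonempty (C ≃o WithTop ℕ)

/-- The admissible sequences of `L`: the strictly increasing sequences that are either finite and
of even length or infinite. -/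
inductive AdmissibleSeq (L : Type u) [PartialOrder L] : Type u
  | finite (l : List L) (strict : l.Pairwise (· < ·)) (even : Even l.length) : AdmissibleSeq L
  | infinite (f : ℕ → L) (strict : StrictMono f) : AdmissibleSeq L

/-- For a finite strictly increasing sequence, remove `0` if it is a term (it is then the first
one), and insert it if it is not. -/
noncomputable def toggleBot {L : Type u} [PartialOrder L] [BoundedOrder L] (l : List L) : List L :=
  open Classical in if ⊥ ∈ l then l.tail else ⊥ :: l

/-- For a finite strictly increasing sequence, remove `1` if it is a term (it is then the last
one), and insert it if it is not. -/
noncomputable def toggleTop {L : Type u} [PartialOrder L] [BoundedOrder L] (l : List L) : List L :=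
  open Classical in if ⊤ ∈ l then l.dropLast else l ++ [⊤]

theorem toggleBot_pairwise {L : Type u} [PartialOrder L] [BoundedOrder L] {l : List L}
    (h : l.Pairwise (· < ·)) : (toggleBot l).Pairwise (· < ·) := by
  unfold toggleBot
  split_ifs with hb
  · exact h.tail
  · refine List.pairwise_cons.2 ⟨fun a ha => bot_lt_iff_ne_bot.2 ?_, h⟩
    rintro rfl
    exact hb ha

theorem toggleTop_pairwise {L : Type u} [PartialOrder L] [BoundedOrder L] {l : List L}
    (h : l.Pairwise (· < ·)) : (toggleTop l).Pairwise (· < ·) := by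
  unfold toggleTop
  split_ifs with ht
  · exact h.sublist (List.dropLast_sublist l)
  · refine List.pairwise_append.2 ⟨h, List.pairwise_singleton _ _, fun a ha b hb => ?_⟩
    rw [List.mem_singleton.1 hb]
    refine lt_top_iff_ne_top.2 ?_
    rintro rfl
    exact ht ha

theorem toggle_even {L : Type u} [PartialOrder L] [BoundedOrder L] {l : List L}
    (h : Even l.length) : Even (toggleTop (toggleBot l)).length := by
  have hb : Odd (toggleBot l).length := by
    unfold toggleBot
    split_ifs with hb
    · have := List.length_pos_of_mem hb
      rw [List.length_tail]
      grind
    · rw [List.length_cons]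
      exact h.add_one
  unfold toggleTop
  split_ifs with ht
  · have := List.length_pos_of_mem ht
    rw [List.length_dropLast]
    grind
  · rw [List.length_append, List.length_singleton]
    exact hb.add_one

namespace AdmissibleSeq

section Order

variable {L : Type u} [PartialOrder L]

/-- `x.get? k` is the term of `x` with index `k` (counted from `0`), if there is one. -/
def get? : AdmissibleSeq L → ℕ → Option L
  | finite l _ _, k => l[k]?
  | infinite f _, k => some (f k)

/-- The set of terms of an admissible sequence. -/
def terms (x : AdmissibleSeq L) : Set L := {a | ∃ k, x.get? k = some a}

/-- The pair `(a, b)` is `(x_{2i}, x_{2i+1})` for some `i < ℓ(x)`. -/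
def IsPair (x : AdmissibleSeq L) (a b : L) : Prop :=
  ∃ i, x.get? (2 * i) = some a ∧ x.get? (2 * i + 1) = some b

/-- The relation `x ⊑ y`: for each `i < ℓ(x)` there is `j < ℓ(y)` with
`y_{2j} ≤ x_{2i} < x_{2i+1} ≤ y_{2j+1}`. -/
def Below (x y : AdmissibleSeq L) : Prop :=
  ∀ a b, x.IsPair a b → ∃ c d, y.IsPair c d ∧ c ≤ a ∧ a < b ∧ b ≤ d

theorem IsPair.lt {x : AdmissibleSeq L} {a b : L} (h : x.IsPair a b) : a < b := by
  obtain ⟨i, h0, h1⟩ := h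
  cases x with
  | finite l hl _ =>
    simp only [get?] at h0 h1
    obtain ⟨p, rfl⟩ := List.getElem?_eq_some_iff.1 h0
    obtain ⟨q, rfl⟩ := List.getElem?_eq_some_iff.1 h1
    exact List.pairwise_iff_getElem.1 hl _ _ p q (Nat.lt_succ_self _)
  | infinite f hf =>
    simp only [get?, Option.some.injEq] at h0 h1
    subst h0 h1
    exact hf (Nat.lt_succ_self _)

/-- The sequence is finite. -/
def IsFinite : AdmissibleSeq L → Prop
  | finite _ _ _ => True
  | infinite _ _ => False

/-- `K*(C)` as a subset of `K*(L)`, for `C ⊆ L`: the admissible sequences with all terms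
in `C`. -/
def inSubset (C : Set L) : Set (AdmissibleSeq L) := {x | x.terms ⊆ C}

/-- The empty sequence. -/
def zero : AdmissibleSeq L := finite [] List.Pairwise.nil (by simp)

end Order

section Bounded

variable {L : Type u} [PartialOrder L] [BoundedOrder L]

/-- The sequence `0 < 1`. -/
def one [Nontrivial L] : AdmissibleSeq L := finite [⊥, ⊤] (by simp) (by simp)

open Classical in
/-- The orthocomplementation on admissible sequences. For a finite `x`, toggle both `0` and `1` as terms.
For an infinite `x`, drop the first term `x₀` if `x₀ = 0`, and put `0` in front of `x`
if `x₀ ≠ 0`. -/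
noncomputable def perp : AdmissibleSeq L → AdmissibleSeq L
  | finite l hl he => finite (toggleTop (toggleBot l))
      (toggleTop_pairwise (toggleBot_pairwise hl)) (toggle_even he)
  | infinite f hf =>
      if h : f 0 = ⊥ then infinite (fun n => f (n + 1)) (fun _ _ hmn => hf (Nat.succ_lt_succ hmn))
      else infinite (fun n => Nat.casesOn n ⊥ f)
        (strictMono_nat_of_lt_succ fun n => by
          cases n with
          | zero => exact bot_lt_iff_ne_bot.2 h
          | succ n => exact hf (Nat.lt_succ_self n))

theorem IsFinite.perp {x : AdmissibleSeq L} (hx : x.IsFinite) : x.perp.IsFinite := by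
  cases x with
  | finite l hl he => trivial
  | infinite f hf => exact hx.elim

end Bounded

end AdmissibleSeq

/-- The Kalmbach construction `K(L)`: the finite strictly increasing sequences of even length. -/
def Kalmbach (L : Type u) [PartialOrder L] : Type u := {x : AdmissibleSeq L // x.IsFinite}

namespace Kalmbach

/-- The inclusion of `K(L)` in `K*(L)`. -/
def toAdmissible {L : Type u} [PartialOrder L] (x : Kalmbach L) : AdmissibleSeq L := x.1

/-- `K(L)` is ordered by `⊑`. -/
instance {L : Type u} [PartialOrder L] : Preorder (Kalmbach L) where
  le x y := x.toAdmissible.Below y.toAdmissible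
  le_refl _ a b h := ⟨a, b, h, le_rfl, h.lt, le_rfl⟩
  le_trans _ _ _ hxy hyz a b h := by
    obtain ⟨c, d, h', hca, hab, hbd⟩ := hxy a b h
    obtain ⟨c', d', h'', hcc, _, hdd⟩ := hyz c d h'
    exact ⟨c', d', h'', hcc.trans hca, hab, hbd.trans hdd⟩

/-- The orthocomplementation of `K(L)`. -/
noncomputable def perp {L : Type u} [PartialOrder L] [BoundedOrder L]
    (x : Kalmbach L) : Kalmbach L := ⟨x.toAdmissible.perp, AdmissibleSeq.IsFinite.perp x.2⟩

end Kalmbach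

/-! Read `x` as a union of half-open intervals `[x_{2i}, x_{2i+1})`, its pairs, each strictly before
the next. The pairs determine `x` (`ext_isPair`). Conversely, any strictly separated set of pairs
comes from a sequence (`exists_of_separated`): the left ends lie in a maximal chain, so if there are
infinitely many they have type `ω`. Hence meets exist: intersect one pair from each sequence and
keep the nonempty intersections (`exists_glb`). The sequence `x.perp` lists the gaps of `x`, and `x
⊑ y.perp` means that no pair of `x` overlaps one of `y` (`below_perp_iff`); a pair cannot lie beyond
infinitely many terms, because only `⊤` bounds a strictly increasing sequence.

Involution and orthomodularity both follow from `below_of_forall_interval`: when all terms are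
comparable, failure of `y ⊑ x` is witnessed by an interval inside `y` that misses `x`. Since `L` is
well-founded, chains of terms have successors. The interval from a term to its successor is not
split by any sequence with terms in that chain, so it acts like a point. Such intervals give atoms
in complete subalgebras and prove distributivity in `K*(C)`. Density of `K(L)` holds because every
element is the join of its pairs, each a finite sequence; complements give the dual. Finally, two
members of a Boolean subalgebra are joins of pairwise orthogonal pieces, so their terms are
comparable; this yields the blocks. -/

namespace AdmissibleSeq

/-! ### Admissible sequences as separated sets of pairs. -/

section Terms

variable {L : Type u} [PartialOrder L] {x y : AdmissibleSeq L}

theorem get?_lt {j k : ℕ} {a b : L} (ha : x.get? j = some a) (hb : x.get? k = some b)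
    (hjk : j < k) : a < b := by
  cases x with
  | finite l hl _ =>
    obtain ⟨p, rfl⟩ := List.getElem?_eq_some_iff.1 ha
    obtain ⟨q, rfl⟩ := List.getElem?_eq_some_iff.1 hb
    exact List.pairwise_iff_getElem.1 hl _ _ p q hjk
  | infinite f hf =>
    simp only [get?, Option.some.injEq] at ha hb
    subst ha hb
    exact hf hjk

theorem get?_le {j k : ℕ} {a b : L} (ha : x.get? j = some a) (hb : x.get? k = some b)
    (hjk : j ≤ k) : a ≤ b := by
  rcases hjk.eq_or_lt with rfl | h
  · rw [ha] at hb
    exact (Option.some.inj hb).le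
  · exact (get?_lt ha hb h).le

theorem get?_inj {j k : ℕ} {a : L} (ha : x.get? j = some a) (hb : x.get? k = some a) : j = k := by
  rcases lt_trichotomy j k with h | h | h
  · exact absurd (get?_lt ha hb h) (lt_irrefl _)
  · exact h
  · exact absurd (get?_lt hb ha h) (lt_irrefl _)

theorem lt_of_get?_lt {j k : ℕ} {a b : L} (ha : x.get? j = some a) (hb : x.get? k = some b)
    (hab : a < b) : j < k := by
  by_contra h
  exact absurd (get?_le hb ha (not_lt.1 h)) hab.not_ge

theorem exists_get?_of_le {j k : ℕ} {b : L} (hb : x.get? k = some b) (hjk : j ≤ k) :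
    ∃ a, x.get? j = some a := by
  cases x with
  | finite l hl _ =>
    obtain ⟨q, rfl⟩ := List.getElem?_eq_some_iff.1 hb
    exact ⟨l[j], List.getElem?_eq_getElem (hjk.trans_lt q)⟩
  | infinite f hf => exact ⟨_, rfl⟩

theorem exists_get?_odd {i : ℕ} {a : L} (ha : x.get? (2 * i) = some a) :
    ∃ b, x.get? (2 * i + 1) = some b := by
  cases x with
  | finite l hl he =>
    obtain ⟨q, rfl⟩ := List.getElem?_eq_some_iff.1 ha
    have : 2 * i + 1 < l.length := by grind
    exact ⟨l[2 * i + 1], List.getElem?_eq_getElem this⟩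
  | infinite f hf => exact ⟨_, rfl⟩

theorem mem_terms_iff {e : L} :
    e ∈ x.terms ↔ ∃ a b, x.IsPair a b ∧ (e = a ∨ e = b) := by
  constructor
  · rintro ⟨k, hk⟩
    rcases Nat.even_or_odd' k with ⟨i, rfl | rfl⟩
    · obtain ⟨b, hb⟩ := exists_get?_odd hk
      exact ⟨e, b, ⟨i, hk, hb⟩, Or.inl rfl⟩
    · obtain ⟨a, ha⟩ := exists_get?_of_le hk (Nat.le_succ (2 * i))
      exact ⟨a, e, ⟨i, ha, hk⟩, Or.inr rfl⟩
  · rintro ⟨a, b, ⟨i, ha, hb⟩, rfl | rfl⟩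
    exacts [⟨_, ha⟩, ⟨_, hb⟩]

theorem IsPair.left_mem {a b : L} (h : x.IsPair a b) : a ∈ x.terms :=
  mem_terms_iff.2 ⟨a, b, h, Or.inl rfl⟩

theorem IsPair.right_mem {a b : L} (h : x.IsPair a b) : b ∈ x.terms :=
  mem_terms_iff.2 ⟨a, b, h, Or.inr rfl⟩

theorem IsPair.eq_or_lt_or_lt {a b c d : L} (h : x.IsPair a b) (h' : x.IsPair c d) :
    (a = c ∧ b = d) ∨ b < c ∨ d < a := by
  obtain ⟨i, ha, hb⟩ := h
  obtain ⟨j, hc, hd⟩ := h'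
  rcases lt_trichotomy i j with hij | rfl | hij
  · exact Or.inr (Or.inl (get?_lt hb hc (by omega)))
  · rw [ha] at hc
    rw [hb] at hd
    exact Or.inl ⟨Option.some.inj hc, Option.some.inj hd⟩
  · exact Or.inr (Or.inr (get?_lt hd ha (by omega)))

theorem ext_get? (h : ∀ k, x.get? k = y.get? k) : x = y := by
  cases x with
  | finite l hl he =>
    cases y with
    | finite l' hl' he' =>
      have : l = l' := List.ext_getElem? h
      subst this
      rfl
    | infinite f hf =>
      have := h l.length
      simp [get?] at this
  | infinite f hf =>
    cases y with
    | finite l' hl' he' =>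
      have := h l'.length
      simp [get?] at this
    | infinite g hg =>
      have : f = g := funext fun k => Option.some.inj (h k)
      subst this
      rfl

/-- Distinct left ends of `x` sit at strictly increasing places in `y`, so no index can drop.
Applied in both directions, this forces equal pair sets to be enumerated with equal indices. -/
theorem exists_index_ge (h : ∀ a b, x.IsPair a b → y.IsPair a b) (i : ℕ) :
    ∀ a, x.get? (2 * i) = some a → ∃ j, i ≤ j ∧ y.get? (2 * j) = some a := by
  induction i with
  | zero =>
    intro a ha
    obtain ⟨b, hb⟩ := exists_get?_odd ha
    obtain ⟨j, hj, -⟩ := h a b ⟨0, ha, hb⟩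
    exact ⟨j, Nat.zero_le _, hj⟩
  | succ i ih =>
    intro a ha
    obtain ⟨b, hb⟩ := exists_get?_odd ha
    obtain ⟨a', ha'⟩ := exists_get?_of_le ha (show 2 * i ≤ 2 * (i + 1) by omega)
    obtain ⟨j, hij, hj⟩ := ih a' ha'
    obtain ⟨k, hk, -⟩ := h a b ⟨i + 1, ha, hb⟩
    have := lt_of_get?_lt hj hk (get?_lt ha' ha (by omega))
    exact ⟨k, by omega, hk⟩

theorem get?_eq_of_isPair (h : ∀ a b, x.IsPair a b ↔ y.IsPair a b) {i : ℕ} {a b : L}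
    (ha : x.get? (2 * i) = some a) (hb : x.get? (2 * i + 1) = some b) :
    y.get? (2 * i) = some a ∧ y.get? (2 * i + 1) = some b := by
  obtain ⟨j, hij, hj⟩ := exists_index_ge (fun a b => (h a b).1) i a ha
  obtain ⟨k, hjk, hk⟩ := exists_index_ge (fun a b => (h a b).2) j a hj
  have h1 := get?_inj ha hk
  obtain ⟨m, hm, hm'⟩ := (h a b).1 ⟨i, ha, hb⟩
  have h2 := get?_inj hj hm
  have : m = i := by omega
  subst this
  exact ⟨hm, hm'⟩

theorem ext_isPair (h : ∀ a b, x.IsPair a b ↔ y.IsPair a b) : x = y := by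
  have key : ∀ {x y : AdmissibleSeq L}, (∀ a b, x.IsPair a b ↔ y.IsPair a b) →
      ∀ k e, x.get? k = some e → y.get? k = some e := by
    intro x y h k e hk
    rcases Nat.even_or_odd' k with ⟨i, rfl | rfl⟩
    · obtain ⟨b, hb⟩ := exists_get?_odd hk
      exact (get?_eq_of_isPair h hk hb).1
    · obtain ⟨a, ha⟩ := exists_get?_of_le hk (Nat.le_succ (2 * i))
      exact (get?_eq_of_isPair h ha hk).2
  refine ext_get? fun k => Option.ext fun e => ⟨key h k e, key (fun a b => (h a b).symm) k e⟩

theorem Below.refl (x : AdmissibleSeq L) : x.Below x :=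
  fun a b h => ⟨a, b, h, le_rfl, h.lt, le_rfl⟩

theorem Below.trans {z : AdmissibleSeq L} (hxy : x.Below y) (hyz : y.Below z) : x.Below z := by
  intro a b h
  obtain ⟨c, d, h', hca, hab, hbd⟩ := hxy a b h
  obtain ⟨c', d', h'', hcc, _, hdd⟩ := hyz c d h'
  exact ⟨c', d', h'', hcc.trans hca, hab, hbd.trans hdd⟩

theorem Below.isPair (hxy : x.Below y) (hyx : y.Below x) {a b : L} (h : x.IsPair a b) :
    y.IsPair a b := by
  obtain ⟨c, d, h', hca, hab, hbd⟩ := hxy a b h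
  obtain ⟨e, f, h'', hec, hcd, hdf⟩ := hyx c d h'
  -- The pair of `x` reached after going to `y` and back contains the original pair; as pairs of `x`
  -- are disjoint, the two coincide.
  rcases h.eq_or_lt_or_lt h'' with ⟨rfl, rfl⟩ | hlt | hlt
  · rwa [le_antisymm hec hca, le_antisymm hbd hdf]
  · exact absurd (hlt.trans_le (hec.trans (hca.trans hab.le))) (lt_irrefl _)
  · exact absurd (hab.trans_le (hbd.trans hdf) |>.trans hlt) (lt_irrefl _)

theorem Below.antisymm (hxy : x.Below y) (hyx : y.Below x) : x = y :=
  ext_isPair fun _ _ => ⟨hxy.isPair hyx, hyx.isPair hxy⟩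

theorem not_isPair_zero (a b : L) : ¬ (zero : AdmissibleSeq L).IsPair a b := by
  rintro ⟨i, h, -⟩
  simp [zero, get?] at h

theorem zero_below (x : AdmissibleSeq L) : zero.Below x :=
  fun a b h => absurd h (not_isPair_zero a b)

theorem exists_isPair_of_ne_zero (h : x ≠ zero) : ∃ a b, x.IsPair a b := by
  by_contra! hx
  exact h (ext_isPair fun a b => ⟨fun h' => absurd h' (hx a b),
    fun h' => absurd h' (not_isPair_zero a b)⟩)

theorem isPair_finite_nil (hl : ([] : List L).Pairwise (· < ·)) (he : Even ([] : List L).length)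
    (a b : L) : ¬ (finite [] hl he).IsPair a b :=
  not_isPair_zero a b

theorem isPair_finite_cons_cons {a b c d : L} {l : List L}
    (hl : (a :: b :: l).Pairwise (· < ·)) (he : Even (a :: b :: l).length)
    (hl' : l.Pairwise (· < ·)) (he' : Even l.length) :
    (finite (a :: b :: l) hl he).IsPair c d ↔ (c = a ∧ d = b) ∨ (finite l hl' he').IsPair c d := by
  constructor
  · rintro ⟨i, hc, hd⟩
    cases i with
    | zero =>
      simp only [get?] at hc hd
      simp at hc hd
      exact Or.inl ⟨hc.symm, hd.symm⟩
    | succ i =>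
      refine Or.inr ⟨i, ?_, ?_⟩
      · simpa [get?, Nat.mul_add] using hc
      · simpa [get?, Nat.mul_add] using hd
  · rintro (⟨rfl, rfl⟩ | ⟨i, hc, hd⟩)
    · exact ⟨0, by simp [get?], by simp [get?]⟩
    · refine ⟨i + 1, ?_, ?_⟩
      · simpa [get?, Nat.mul_add] using hc
      · simpa [get?, Nat.mul_add] using hd

/-- The sequence `a < b`. -/
def interval (a b : L) (h : a < b) : AdmissibleSeq L := finite [a, b] (by simpa using h) (by simp)

theorem isPair_interval {a b c d : L} (h : a < b) :
    (interval a b h).IsPair c d ↔ c = a ∧ d = b := by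
  rw [interval, isPair_finite_cons_cons _ _ List.Pairwise.nil (by simp)]
  simp [isPair_finite_nil]

theorem interval_below_iff {a b : L} (h : a < b) :
    (interval a b h).Below x ↔ ∃ c d, x.IsPair c d ∧ c ≤ a ∧ b ≤ d := by
  constructor
  · intro H
    obtain ⟨c, d, h1, h2, -, h3⟩ := H a b ((isPair_interval h).2 ⟨rfl, rfl⟩)
    exact ⟨c, d, h1, h2, h3⟩
  · rintro ⟨c, d, h1, h2, h3⟩ a' b' hab
    obtain ⟨rfl, rfl⟩ := (isPair_interval h).1 hab
    exact ⟨c, d, h1, h2, h, h3⟩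

theorem below_iff_forall_interval :
    x.Below y ↔ ∀ a b (h : x.IsPair a b), (interval a b h.lt).Below y := by
  constructor
  · intro H a b h
    obtain ⟨c, d, h1, h2, -, h3⟩ := H a b h
    exact (interval_below_iff _).2 ⟨c, d, h1, h2, h3⟩
  · intro H a b h
    obtain ⟨c, d, h1, h2, h3⟩ := (interval_below_iff _).1 (H a b h)
    exact ⟨c, d, h1, h2, h.lt, h3⟩

theorem exists_finite_of_separated (n : ℕ) : ∀ S : Set (L × L), S.Finite → S.ncard = n →
    (∀ p ∈ S, p.1 < p.2) → (∀ p ∈ S, ∀ q ∈ S, p = q ∨ p.2 < q.1 ∨ q.2 < p.1) →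
    ∃ (l : List L) (hl : l.Pairwise (· < ·)) (he : Even l.length),
      ∀ a b, (finite l hl he).IsPair a b ↔ (a, b) ∈ S := by
  induction n with
  | zero =>
    intro S hS hn _ _
    rw [Set.ncard_eq_zero hS] at hn
    subst hn
    exact ⟨[], List.Pairwise.nil, by simp, fun a b => by simp [isPair_finite_nil]⟩
  | succ n ih =>
    intro S hS hn hlt hsep
    -- By separation, the pair with minimal left end precedes all the others and can be put at the
    -- head of the list.
    obtain ⟨p, hp, hmin⟩ := hS.exists_minimalFor Prod.fst S
      (Set.nonempty_of_ncard_ne_zero (by omega))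
    obtain ⟨l, hl, he, h⟩ := ih (S \ {p}) (hS.subset Set.sdiff_subset)
      (by rw [Set.ncard_sdiff_singleton_of_mem hp]; omega)
      (fun q hq => hlt q hq.1) (fun q hq r hr => hsep q hq.1 r hr.1)
    have hgt : ∀ e ∈ l, p.2 < e := by
      intro e hel
      obtain ⟨k, hk⟩ := List.mem_iff_getElem?.1 hel
      obtain ⟨a, b, hab, heab⟩ := mem_terms_iff.1 (⟨k, hk⟩ : e ∈ (finite l hl he).terms)
      have hae : a ≤ e := by
        rcases heab with rfl | rfl
        exacts [le_rfl, hab.lt.le]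
      have hS' := (h a b).1 hab
      rcases hsep p hp _ hS'.1 with h1 | h1 | h1
      · exact absurd h1.symm hS'.2
      · exact h1.trans_le hae
      · have h2 : a < p.1 := hab.lt.trans h1
        exact absurd (hmin hS'.1 h2.le) h2.not_ge
    have hl' : (p.1 :: p.2 :: l).Pairwise (· < ·) := by
      refine List.pairwise_cons.2 ⟨?_, List.pairwise_cons.2 ⟨hgt, hl⟩⟩
      intro e hel
      rcases List.mem_cons.1 hel with rfl | hel
      exacts [hlt p hp, (hlt p hp).trans (hgt e hel)]
    have he' : Even (p.1 :: p.2 :: l).length := by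
      rw [List.length_cons, List.length_cons]
      exact he.add_one.add_one
    refine ⟨p.1 :: p.2 :: l, hl', he', fun a b => ?_⟩
    rw [isPair_finite_cons_cons hl' he' hl he, h]
    constructor
    · rintro (⟨rfl, rfl⟩ | h)
      exacts [hp, h.1]
    · intro hab
      by_cases hpab : (a, b) = p
      · subst hpab
        exact Or.inl ⟨rfl, rfl⟩
      · exact Or.inr ⟨hab, hpab⟩

theorem exists_infinite_of_enum (g : ℕ → L × L) (hlt : ∀ n, (g n).1 < (g n).2)
    (hsep : ∀ n, (g n).2 < (g (n + 1)).1) :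
    ∃ x : AdmissibleSeq L, ∀ a b, x.IsPair a b ↔ ∃ n, g n = (a, b) := by
  have hf : StrictMono fun k : ℕ => if Even k then (g (k / 2)).1 else (g (k / 2)).2 := by
    refine strictMono_nat_of_lt_succ fun k => ?_
    rcases Nat.even_or_odd' k with ⟨i, rfl | rfl⟩
    · have h1 : (2 * i + 1) / 2 = i := by omega
      simp [h1, hlt]
    · have h1 : (2 * i + 1) / 2 = i := by omega
      have h2 : (2 * i + 1 + 1) / 2 = i + 1 := by omega
      have h3 : Even (2 * i + 1 + 1) := ⟨i + 1, by omega⟩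
      simp [h1, h2, h3, hsep]
  refine ⟨infinite _ hf, fun a b => exists_congr fun n => ?_⟩
  have h1 : (2 * n + 1) / 2 = n := by omega
  simp [get?, h1, Prod.ext_iff]

end Terms

end AdmissibleSeq

/-! ### Well-foundedness, completeness and increasing sequences in `L`. -/

namespace IsOmegaPlusOneLattice

variable {L : Type u} [Lattice L]

theorem wellFoundedLT (hL : IsOmegaPlusOneLattice L) : WellFoundedLT L := by
  rw [WellFoundedLT, isWellFounded_iff, RelEmbedding.wellFounded_iff_isEmpty]
  refine ⟨fun f => ?_⟩
  have hf : StrictAnti f := fun m n h => f.map_rel_iff.2 h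
  obtain ⟨C, hC, hfC⟩ := hf.antitone.isChain_range.exists_maxChain
  have hmem : ∀ n, f n ∈ C := fun n => hfC ⟨n, rfl⟩
  have hwf : WellFoundedLT C := by
    rcases hL C hC with h | ⟨⟨e⟩⟩
    · have := h.to_subtype
      exact Finite.to_wellFoundedLT
    · exact e.strictMono.wellFoundedLT
  rw [WellFoundedLT, isWellFounded_iff, RelEmbedding.wellFounded_iff_isEmpty] at hwf
  exact hwf.false ⟨⟨fun n => ⟨f n, hmem n⟩, fun m n h => hf.injective (congrArg Subtype.val h)⟩,
    fun {m n} => f.map_rel_iff⟩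

/-- In a maximal chain through the sequence and `u`, an element below `⊤` corresponds to a natural
number, which has only finitely many predecessors. -/
theorem eq_top_of_strictMono [BoundedOrder L] (hL : IsOmegaPlusOneLattice L) {f : ℕ → L}
    (hf : StrictMono f) {u : L} (hu : ∀ n, f n ≤ u) : u = ⊤ := by
  by_contra hne
  have hch : IsChain (· ≤ ·) (insert u (Set.range f)) :=
    hf.monotone.isChain_range.insert (by rintro _ ⟨n, rfl⟩ -; exact Or.inr (hu n))
  obtain ⟨C, hC, hfC⟩ := hch.exists_maxChain
  have hmem : ∀ n, f n ∈ C := fun n => hfC (Or.inr ⟨n, rfl⟩)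
  rcases hL C hC with h | ⟨⟨e⟩⟩
  · exact Set.infinite_of_injective_forall_mem hf.injective hmem h
  · have hlt : e ⟨u, hfC (Or.inl rfl)⟩ < ⊤ :=
      (e.strictMono (show (⟨u, hfC (Or.inl rfl)⟩ : C) < ⟨⊤, hC.top_mem⟩ from
        lt_top_iff_ne_top.2 hne)).trans_le le_top
    obtain ⟨k, hk⟩ := WithTop.ne_top_iff_exists.1 hlt.ne
    have hfe : ∀ n : ℕ, e ⟨f n, hmem n⟩ ≤ WithTop.some k := fun n => by
      rw [hk]
      exact e.monotone (hu n)
    choose g hg using fun n => WithTop.ne_top_iff_exists.1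
      ((hfe n).trans_lt (WithTop.coe_lt_top k)).ne
    have hgm : StrictMono g := fun m n hmn => by
      rw [← WithTop.coe_lt_coe, hg, hg]
      exact e.strictMono (show (⟨f m, hmem m⟩ : C) < ⟨f n, hmem n⟩ from hf hmn)
    have h1 : g (k + 1) ≤ k := by
      rw [← WithTop.coe_le_coe, hg]
      exact hfe _
    have h2 : k + 1 ≤ g (k + 1) := hgm.le_apply
    omega

theorem exists_isGLB [OrderTop L] (hL : IsOmegaPlusOneLattice L) (X : Set L) : ∃ a, IsGLB X a := by
  have := hL.wellFoundedLT
  -- A minimal meet of finitely many members of `X` cannot be lowered by one more member, so it is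
  -- already a lower bound of `X`.
  obtain ⟨m, ⟨F, hF, rfl⟩, hm⟩ := (wellFounded_lt (α := L)).has_min
    {m | ∃ F : Finset L, (F : Set L) ⊆ X ∧ F.inf id = m} ⟨_, ∅, by simp, rfl⟩
  refine ⟨F.inf id, fun x hx => ?_, fun b hb => Finset.le_inf fun x hx => hb (hF hx)⟩
  classical
  have h1 : ¬ (insert x F).inf id < F.inf id := by
    refine hm _ ⟨insert x F, ?_, rfl⟩
    rw [Finset.coe_insert]
    exact Set.insert_subset hx hF
  rw [Finset.inf_insert] at h1
  by_contra h
  exact h1 (inf_lt_right.2 fun h' => h h')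

theorem exists_isLUB [OrderTop L] (hL : IsOmegaPlusOneLattice L) (X : Set L) : ∃ a, IsLUB X a := by
  obtain ⟨a, ha⟩ := hL.exists_isGLB (upperBounds X)
  exact ⟨a, isGLB_upperBounds.1 ha⟩

end IsOmegaPlusOneLattice

/-! ### Building sequences from pairs; arbitrary meets. -/

namespace AdmissibleSeq

variable {L : Type u} [Lattice L] {x y : AdmissibleSeq L}

theorem exists_of_separated [BoundedOrder L] (hL : IsOmegaPlusOneLattice L) (S : Set (L × L))
    (hlt : ∀ p ∈ S, p.1 < p.2) (hsep : ∀ p ∈ S, ∀ q ∈ S, p = q ∨ p.2 < q.1 ∨ q.2 < p.1) :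
    ∃ x : AdmissibleSeq L, ∀ a b, x.IsPair a b ↔ (a, b) ∈ S := by
  by_cases hS : S.Finite
  · obtain ⟨l, hl, he, h⟩ := exists_finite_of_separated _ S hS rfl hlt hsep
    exact ⟨_, h⟩
  have hinj : Set.InjOn Prod.fst S := by
    intro p hp q hq hpq
    have hp' := hlt p hp
    have hq' := hlt q hq
    rcases hsep p hp q hq with h | h | h
    · exact h
    · rw [hpq] at hp'
      exact absurd (hp'.trans h) (lt_irrefl _)
    · rw [← hpq] at hq'
      exact absurd (hq'.trans h) (lt_irrefl _)
  have hch : IsChain (· ≤ ·) (Prod.fst '' S) := by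
    rintro _ ⟨p, hp, rfl⟩ _ ⟨q, hq, rfl⟩ -
    rcases hsep p hp q hq with h | h | h
    · exact Or.inl (h ▸ le_rfl)
    · exact Or.inl ((hlt p hp).trans h).le
    · exact Or.inr ((hlt q hq).trans h).le
  obtain ⟨C, hC, hSC⟩ := hch.exists_maxChain
  rcases hL C hC with h | ⟨⟨e⟩⟩
  · exact absurd (Set.Finite.of_finite_image (h.subset hSC) hinj) hS
  have hmem : ∀ p ∈ S, p.1 ∈ C := fun p hp => hSC ⟨p, hp, rfl⟩
  -- A left end is strictly below its right end, hence is not `⊤` and corresponds to a finite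
  -- position in the chain.
  have hφ : ∀ p (hp : p ∈ S), ∃ n : ℕ, WithTop.some n = e ⟨p.1, hmem p hp⟩ := by
    intro p hp
    refine WithTop.ne_top_iff_exists.1 (ne_of_lt ?_)
    exact (e.strictMono (show (⟨p.1, hmem p hp⟩ : C) < ⟨⊤, hC.top_mem⟩ from
        (hlt p hp).trans_le le_top)).trans_le le_top
  let N : Set ℕ := {n | ∃ p, ∃ hp : p ∈ S, WithTop.some n = e ⟨p.1, hmem p hp⟩}
  have hN : N.Infinite := by
    intro hfin
    refine hS (Set.Finite.of_finite_image (f := Prod.fst) ?_ hinj)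
    refine Set.Finite.subset
      (Set.Finite.image (fun n => ((e.symm (WithTop.some n) : C) : L)) (show N.Finite from hfin)) ?_
    rintro _ ⟨p, hp, rfl⟩
    obtain ⟨n, hn⟩ := hφ p hp
    exact ⟨n, ⟨p, hp, hn⟩, by simp [hn]⟩
  have : Infinite N := hN.to_subtype
  classical
  let o := Nat.Subtype.orderIsoOfNat N
  choose g hg hge using fun n : ℕ => (o n).2
  have hgsep : ∀ n, (g n).2 < (g (n + 1)).1 := by
    intro n
    have h1 : e ⟨(g n).1, hmem _ (hg n)⟩ < e ⟨(g (n + 1)).1, hmem _ (hg _)⟩ := by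
      rw [← hge, ← hge]
      exact WithTop.coe_lt_coe.2 (o.strictMono (Nat.lt_succ_self n))
    have h2 : (g n).1 < (g (n + 1)).1 := e.lt_iff_lt.1 h1
    rcases hsep _ (hg n) _ (hg (n + 1)) with h | h | h
    · exact absurd (congrArg Prod.fst h) h2.ne
    · exact h
    · exact absurd ((hlt _ (hg (n + 1))).trans h) h2.not_gt
  obtain ⟨x, hx⟩ := exists_infinite_of_enum g (fun n => hlt _ (hg n)) hgsep
  refine ⟨x, fun a b => (hx a b).trans ⟨?_, fun h => ?_⟩⟩
  · rintro ⟨n, hn⟩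
    exact hn ▸ hg n
  · obtain ⟨n, hn⟩ := hφ _ h
    refine ⟨o.symm ⟨n, _, h, hn⟩, ?_⟩
    have h1 := hge (o.symm ⟨n, _, h, hn⟩)
    rw [OrderIso.apply_symm_apply] at h1
    have h2 := e.injective (h1.symm.trans hn)
    exact hinj (hg _) h (congrArg Subtype.val h2)

/-- A choice of one pair from each member of `F` contributes its intersection, if nonempty. Two
choices that differ at some `y` give separated intersections, because the pairs of `y` are
separated. The description of the pairs is kept to control the terms of a meet. -/
theorem exists_glb [BoundedOrder L] (hL : IsOmegaPlusOneLattice L) (F : Set (AdmissibleSeq L)) :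
    ∃ m : AdmissibleSeq L, (∀ z : AdmissibleSeq L, z.Below m ↔ ∀ y ∈ F, z.Below y) ∧
      ∀ a b, m.IsPair a b → ∃ g : AdmissibleSeq L → L × L, (∀ y ∈ F, y.IsPair (g y).1 (g y).2) ∧
        IsLUB ((fun y => (g y).1) '' F) a ∧ IsGLB ((fun y => (g y).2) '' F) b := by
  obtain ⟨m, hm⟩ := exists_of_separated hL {p : L × L | p.1 < p.2 ∧
      ∃ g : AdmissibleSeq L → L × L, (∀ y ∈ F, y.IsPair (g y).1 (g y).2) ∧
        IsLUB ((fun y => (g y).1) '' F) p.1 ∧ IsGLB ((fun y => (g y).2) '' F) p.2}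
    (fun p hp => hp.1) (by
      rintro p ⟨hp, g, hg, hg1, hg2⟩ q ⟨hq, g', hg', hg1', hg2'⟩
      by_cases heq : ∀ y ∈ F, g y = g' y
      · left
        have h1 : (fun y => (g y).1) '' F = (fun y => (g' y).1) '' F :=
          Set.image_congr fun y hy => by rw [heq y hy]
        have h2 : (fun y => (g y).2) '' F = (fun y => (g' y).2) '' F :=
          Set.image_congr fun y hy => by rw [heq y hy]
        rw [h1] at hg1
        rw [h2] at hg2
        exact Prod.ext (hg1.unique hg1') (hg2.unique hg2')
      · push Not at heq
        obtain ⟨y, hy, hne⟩ := heq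
        right
        rcases (hg y hy).eq_or_lt_or_lt (hg' y hy) with h | h | h
        · exact absurd (Prod.ext h.1 h.2) hne
        · exact Or.inl (((hg2.1 ⟨y, hy, rfl⟩).trans_lt h).trans_le (hg1'.1 ⟨y, hy, rfl⟩))
        · exact Or.inr (((hg2'.1 ⟨y, hy, rfl⟩).trans_lt h).trans_le (hg1.1 ⟨y, hy, rfl⟩)))
  refine ⟨m, fun z => ⟨fun h y hy => h.trans ?_, fun h => ?_⟩, fun a b hab => ((hm a b).1 hab).2⟩
  · intro a b hab
    obtain ⟨-, g, hg, h1, h2⟩ := (hm a b).1 hab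
    exact ⟨_, _, hg y hy, h1.1 ⟨y, hy, rfl⟩, hab.lt, h2.1 ⟨y, hy, rfl⟩⟩
  · intro a b hab
    have : ∀ y : AdmissibleSeq L, ∃ p : L × L, y ∈ F → y.IsPair p.1 p.2 ∧ p.1 ≤ a ∧ b ≤ p.2 := by
      intro y
      by_cases hy : y ∈ F
      · obtain ⟨c, d, h1, h2, -, h3⟩ := h y hy a b hab
        exact ⟨(c, d), fun _ => ⟨h1, h2, h3⟩⟩
      -- The value outside `F` is arbitrary.
      · exact ⟨(a, a), fun h => absurd h hy⟩
    choose g hg using this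
    obtain ⟨c, hc⟩ := hL.exists_isLUB ((fun y => (g y).1) '' F)
    obtain ⟨d, hd⟩ := hL.exists_isGLB ((fun y => (g y).2) '' F)
    have hca : c ≤ a := hc.2 (by rintro _ ⟨y, hy, rfl⟩; exact (hg y hy).2.1)
    have hbd : b ≤ d := hd.2 (by rintro _ ⟨y, hy, rfl⟩; exact (hg y hy).2.2)
    exact ⟨c, d, (hm c d).2 ⟨(hca.trans_lt hab.lt).trans_le hbd, g, fun y hy => (hg y hy).1, hc, hd⟩,
      hca, hab.lt, hbd⟩

theorem exists_inf [BoundedOrder L] (hL : IsOmegaPlusOneLattice L) (x y : AdmissibleSeq L) :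
    ∃ m : AdmissibleSeq L, (∀ z : AdmissibleSeq L, z.Below m ↔ z.Below x ∧ z.Below y) ∧
      ∀ a b, m.IsPair a b → ∃ p q : L × L, x.IsPair p.1 p.2 ∧ y.IsPair q.1 q.2 ∧
        a = p.1 ⊔ q.1 ∧ b = p.2 ⊓ q.2 := by
  obtain ⟨m, h1, h2⟩ := exists_glb hL {x, y}
  refine ⟨m, fun z => by simp [h1], fun a b hab => ?_⟩
  obtain ⟨g, hg, ha, hb⟩ := h2 a b hab
  rw [Set.image_pair] at ha hb
  exact ⟨g x, g y, hg x (by simp), hg y (by simp), ha.unique isLUB_pair, hb.unique isGLB_pair⟩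

end AdmissibleSeq

/-- The default `⊤` supplies the partner of the unpaired last entry. If that entry is `⊤` itself,
the result is a degenerate pair, which `c < d` discards. -/
theorem toggleTop_getElem? {L : Type u} [PartialOrder L] [BoundedOrder L] {m : List L}
    (hm : m.Pairwise (· < ·)) (ho : Odd m.length) (i : ℕ) (c d : L) :
    ((toggleTop m)[2 * i]? = some c ∧ (toggleTop m)[2 * i + 1]? = some d) ↔
      c < d ∧ m[2 * i]? = some c ∧ d = m[2 * i + 1]?.getD ⊤ := by
  have hs := toggleTop_pairwise hm
  have hlt : (toggleTop m)[2 * i]? = some c → (toggleTop m)[2 * i + 1]? = some d → c < d := by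
    intro hc hd
    obtain ⟨p, rfl⟩ := List.getElem?_eq_some_iff.1 hc
    obtain ⟨q, rfl⟩ := List.getElem?_eq_some_iff.1 hd
    exact List.pairwise_iff_getElem.1 hs _ _ p q (Nat.lt_succ_self _)
  obtain ⟨n, hn⟩ := ho
  by_cases ht : ⊤ ∈ m
  · obtain ⟨m', e, rfl⟩ := List.eq_nil_or_concat m |>.resolve_left (List.ne_nil_of_mem ht)
    rw [List.concat_eq_append] at *
    have he : e = ⊤ := by
      rcases List.mem_append.1 ht with h | h
      · exact absurd ((List.pairwise_append.1 hm).2.2 _ h e (by simp)) not_top_lt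
      · exact (List.mem_singleton.1 h).symm
    subst he
    have htog : toggleTop (m' ++ [⊤]) = m' := by simp [toggleTop]
    rw [htog] at hlt ⊢
    have hlen : m'.length = 2 * n := by simpa using hn
    rcases lt_trichotomy i n with h | h | h
    · have h1 : 2 * i < m'.length := by omega
      have h2 : 2 * i + 1 < m'.length := by omega
      rw [List.getElem?_append_left h1, List.getElem?_append_left h2]
      rw [List.getElem?_eq_getElem h1, List.getElem?_eq_getElem h2] at hlt ⊢
      simp only [Option.some.injEq, Option.getD_some] at hlt ⊢
      grind
    · subst h
      simp only [List.getElem?_eq_none (show m'.length ≤ 2 * i by omega), reduceCtorEq, false_and,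
        false_iff, not_and]
      rw [List.getElem?_append_right (by omega), List.getElem?_append_right (by omega), hlen]
      simp
      rintro h rfl
      exact absurd h not_top_lt
    · rw [List.getElem?_eq_none (by omega), List.getElem?_eq_none (l := m' ++ [⊤]) (by simp; omega)]
      simp
  · have htog : toggleTop m = m ++ [⊤] := by simp [toggleTop, ht]
    rw [htog] at hlt ⊢
    rcases lt_trichotomy i n with h | h | h
    · have h1 : 2 * i < m.length := by omega
      have h2 : 2 * i + 1 < m.length := by omega
      rw [List.getElem?_append_left h1, List.getElem?_append_left h2] at hlt ⊢
      rw [List.getElem?_eq_getElem h1, List.getElem?_eq_getElem h2] at hlt ⊢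
      simp only [Option.some.injEq, Option.getD_some] at hlt ⊢
      grind
    · subst h
      have h1 : 2 * i < m.length := by omega
      rw [List.getElem?_append_left h1, List.getElem?_append_right (by omega), hn] at hlt ⊢
      rw [List.getElem?_eq_none (l := m) (i := 2 * i + 1) (by omega)]
      simp at hlt ⊢
      grind
    · rw [List.getElem?_eq_none (by simp; omega), List.getElem?_eq_none (l := m) (by omega)]
      simp

/-! ### Orthogonality, gaps and the orthocomplement. -/

namespace AdmissibleSeq

section

variable {L : Type u} [PartialOrder L] {x y : AdmissibleSeq L}

/-- Two admissible sequences are orthogonal if no pair of one overlaps a pair of the other. -/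
def Orthogonal (x y : AdmissibleSeq L) : Prop :=
  ∀ a b c d, x.IsPair a b → y.IsPair c d → b ≤ c ∨ d ≤ a

theorem Orthogonal.symm (h : x.Orthogonal y) : y.Orthogonal x :=
  fun a b c d hab hcd => (h c d a b hcd hab).symm

theorem Orthogonal.mono {z : AdmissibleSeq L} (h : y.Orthogonal z) (hxy : x.Below y) :
    x.Orthogonal z := by
  intro a b c d hab hcd
  obtain ⟨a', b', h', h1, -, h2⟩ := hxy a b hab
  exact (h a' b' c d h' hcd).imp h2.trans fun h => h.trans h1

theorem eq_zero_of_orthogonal_self (h : x.Orthogonal x) : x = zero := by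
  by_contra hne
  obtain ⟨a, b, hab⟩ := exists_isPair_of_ne_zero hne
  rcases h a b a b hab hab with h | h <;> exact hab.lt.not_ge h

theorem isChain_terms (x : AdmissibleSeq L) : IsChain (· ≤ ·) x.terms := by
  rintro a ⟨j, hj⟩ b ⟨k, hk⟩ -
  exact (le_total j k).imp (get?_le hj hk) (get?_le hk hj)

/-- An interval `c < d` that is comparable with all terms of `x` and not contained in a pair of `x`
has a subinterval that overlaps no pair of `x`. -/
theorem exists_gap [WellFoundedLT L] {c d : L} (hcd : c < d)
    (hc : ∀ e ∈ x.terms, e ≤ c ∨ c ≤ e) (hd : ∀ e ∈ x.terms, e ≤ d ∨ d ≤ e)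
    (hn : ¬ ∃ a b, x.IsPair a b ∧ a ≤ c ∧ d ≤ b) :
    ∃ (e f : L) (hef : e < f), c ≤ e ∧ f ≤ d ∧ (interval e f hef).Orthogonal x := by
  obtain ⟨e, hce, hed, he⟩ : ∃ e, c ≤ e ∧ e < d ∧
      ∀ a b, x.IsPair a b → b ≤ e ∨ e < a := by
    by_cases h : ∃ a b, x.IsPair a b ∧ a ≤ c ∧ c ≤ b
    · obtain ⟨a, b, hab, hac, hcb⟩ := h
      have hbd : ¬ d ≤ b := fun h' => hn ⟨a, b, hab, hac, h'⟩
      have hbd' : b ≤ d := (hd b hab.right_mem).resolve_right hbd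
      refine ⟨b, hcb, lt_of_le_not_ge hbd' hbd, fun a' b' h' => ?_⟩
      rcases hab.eq_or_lt_or_lt h' with ⟨rfl, rfl⟩ | h | h
      · exact Or.inl le_rfl
      · exact Or.inr h
      · exact Or.inl (h.le.trans hab.lt.le)
    · refine ⟨c, le_rfl, hcd, fun a b hab => ?_⟩
      by_contra! hcon
      refine h ⟨a, b, hab, ?_, (hc b hab.right_mem).resolve_left hcon.1⟩
      rcases hc a hab.left_mem with h | h
      · exact h
      · exact (h.eq_or_lt.resolve_right hcon.2).ge
  -- Stop at the first term of `x` after `e`, or at `d` if that comes sooner.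
  obtain ⟨f, ⟨hef, hfd, hf⟩, hmin⟩ := (wellFounded_lt (α := L)).has_min
    {f | e < f ∧ f ≤ d ∧ (f = d ∨ f ∈ x.terms)} ⟨d, hed, le_rfl, Or.inl rfl⟩
  refine ⟨e, f, hef, hce, hfd, fun e' f' a b hef' hab => ?_⟩
  obtain ⟨rfl, rfl⟩ := (isPair_interval hef).1 hef'
  refine (he a b hab).symm.imp (fun hea => ?_) id
  rcases hd a hab.left_mem with h | h
  · have h1 := hmin a ⟨hea, h, Or.inr hab.left_mem⟩
    rcases hf with rfl | hf
    · exact (h.eq_or_lt.resolve_right h1).ge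
    · rcases (isChain_terms x).total hf hab.left_mem with h' | h'
      · exact h'
      · exact (h'.eq_or_lt.resolve_right h1).ge
  · exact hfd.trans h

end

section

variable {L : Type u} [PartialOrder L] [BoundedOrder L] {x y : AdmissibleSeq L}

/-- The pairs of `x.perp` are the gaps of `x`, from `⊥` or a right end up to the next left end or
`⊤`. The condition `c < d` removes the empty gaps, so one formula covers all toggling cases. -/
theorem isPair_perp_iff {c d : L} : x.perp.IsPair c d ↔ c < d ∧
    ((c = ⊥ ∧ d = (x.get? 0).getD ⊤) ∨
      ∃ i, x.get? (2 * i + 1) = some c ∧ d = (x.get? (2 * i + 2)).getD ⊤) := by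
  cases x with
  | finite l hl he =>
    have hodd : Odd (toggleBot l).length := by
      unfold toggleBot
      split_ifs with hb
      · have := List.length_pos_of_mem hb
        rw [List.length_tail]
        grind
      · rw [List.length_cons]
        exact he.add_one
    have h1 : (perp (finite l hl he)).IsPair c d ↔
        c < d ∧ ∃ i, (toggleBot l)[2 * i]? = some c ∧ d = (toggleBot l)[2 * i + 1]?.getD ⊤ := by
      rw [← exists_and_left]
      exact exists_congr fun i => toggleTop_getElem? (toggleBot_pairwise hl) hodd i c d
    rw [h1]
    refine and_congr_right fun hcd => ?_
    simp only [get?]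
    by_cases hb : ⊥ ∈ l
    · cases l with
      | nil => simp at hb
      | cons e l =>
        have he : e = ⊥ := by
          rcases List.mem_cons.1 hb with h | h
          · exact h.symm
          · exact absurd ((List.pairwise_cons.1 hl).1 _ h) not_lt_bot
        subst he
        have : ¬ (c = ⊥ ∧ d = (⊥ : L)) := by
          rintro ⟨rfl, rfl⟩
          exact lt_irrefl _ hcd
        simp [toggleBot, this]
    · have htog : toggleBot l = ⊥ :: l := by simp [toggleBot, hb]
      rw [htog]
      constructor
      · rintro ⟨i, hc, hd⟩
        cases i with
        | zero => exact Or.inl ⟨by simpa using hc.symm, by simpa using hd⟩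
        | succ i => exact Or.inr ⟨i, by simpa [Nat.mul_add] using hc, by simpa [Nat.mul_add] using hd⟩
      · rintro (⟨rfl, hd⟩ | ⟨i, hc, hd⟩)
        · exact ⟨0, by simp, by simpa using hd⟩
        · exact ⟨i + 1, by simpa [Nat.mul_add] using hc, by simpa [Nat.mul_add] using hd⟩
  | infinite f hf =>
    simp only [get?, Option.some.injEq, Option.getD_some]
    by_cases h : f 0 = ⊥
    · have : ¬ (c < d ∧ c = ⊥ ∧ d = f 0) := by
        rintro ⟨hcd, rfl, rfl⟩
        rw [h] at hcd
        exact lt_irrefl _ hcd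
      rw [and_or_left, or_iff_right this]
      simp only [perp, h, dite_true, IsPair, get?, Option.some.injEq]
      constructor
      · rintro ⟨i, rfl, rfl⟩
        exact ⟨hf (by omega), i, rfl, rfl⟩
      · rintro ⟨-, i, rfl, rfl⟩
        exact ⟨i, rfl, rfl⟩
    · simp only [perp, h, dite_false, IsPair, get?, Option.some.injEq]
      constructor
      · rintro ⟨i, rfl, rfl⟩
        cases i with
        | zero => exact ⟨bot_lt_iff_ne_bot.2 h, Or.inl ⟨rfl, rfl⟩⟩
        | succ i => exact ⟨hf (Nat.lt_succ_self _), Or.inr ⟨i, rfl, rfl⟩⟩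
      · rintro ⟨-, ⟨rfl, rfl⟩ | ⟨i, rfl, rfl⟩⟩
        exacts [⟨0, rfl, rfl⟩, ⟨i + 1, rfl, rfl⟩]

theorem terms_perp_subset {e : L} (he : e ∈ x.perp.terms) : e ∈ x.terms ∨ e = ⊥ ∨ e = ⊤ := by
  have getD : ∀ k, (x.get? k).getD ⊤ ∈ x.terms ∨ (x.get? k).getD ⊤ = ⊤ := fun k => by
    cases h : x.get? k with
    | none => exact Or.inr rfl
    | some a => exact Or.inl ⟨k, h⟩
  obtain ⟨a, b, hab, hee⟩ := mem_terms_iff.1 he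
  obtain ⟨-, ⟨ha, hb⟩ | ⟨i, ha, hb⟩⟩ := isPair_perp_iff.1 hab
  · rcases hee with rfl | rfl
    · exact Or.inr (Or.inl ha)
    · rw [hb]
      exact (getD 0).imp id Or.inr
  · rcases hee with rfl | rfl
    · exact Or.inl ⟨_, ha⟩
    · rw [hb]
      exact (getD _).imp id Or.inr

theorem perp_orthogonal (x : AdmissibleSeq L) : x.perp.Orthogonal x := by
  rintro c d a b hcd ⟨j, ha, hb⟩
  obtain ⟨-, ⟨rfl, rfl⟩ | ⟨i, hc, rfl⟩⟩ := isPair_perp_iff.1 hcd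
  · obtain ⟨e, he⟩ := exists_get?_of_le ha (Nat.zero_le _)
    rw [he]
    exact Or.inl (get?_le he ha (Nat.zero_le _))
  · rcases le_or_gt j i with h | h
    · exact Or.inr (get?_le hb hc (by omega))
    · obtain ⟨e, he⟩ := exists_get?_of_le ha (show 2 * i + 2 ≤ 2 * j by omega)
      rw [he]
      exact Or.inl (get?_le he ha (by omega))

end

section

variable {L : Type u} [Lattice L] [BoundedOrder L] {x y : AdmissibleSeq L}

theorem below_perp_iff (hL : IsOmegaPlusOneLattice L) : x.Below y.perp ↔ x.Orthogonal y := by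
  refine ⟨fun h => (perp_orthogonal y).mono h, fun h a b hab => ?_⟩
  suffices ∃ c d, c ≤ a ∧ b ≤ d ∧ ((c = ⊥ ∧ d = (y.get? 0).getD ⊤) ∨
      ∃ i, y.get? (2 * i + 1) = some c ∧ d = (y.get? (2 * i + 2)).getD ⊤) by
    obtain ⟨c, d, hc, hd, H⟩ := this
    exact ⟨c, d, isPair_perp_iff.2 ⟨hc.trans_lt (hab.lt.trans_le hd), H⟩, hc, hab.lt, hd⟩
  -- If pair `i` of `y` does not end by `a`, orthogonality makes it start after `b`; if there is no
  -- such pair, the gap runs up to `⊤`.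
  have hstep : ∀ i, (∀ e, y.get? (2 * i + 1) = some e → ¬ e ≤ a) →
      b ≤ (y.get? (2 * i)).getD ⊤ := by
    intro i hi
    cases hc : y.get? (2 * i) with
    | none => exact le_top
    | some c =>
      obtain ⟨d, hd⟩ := exists_get?_odd hc
      exact (h a b c d hab ⟨i, hc, hd⟩).resolve_right (hi d hd)
  by_cases h0 : ∃ e, y.get? 1 = some e ∧ e ≤ a
  · have hex : ∃ i, ¬ ∃ e, y.get? (2 * i + 1) = some e ∧ e ≤ a := by
      by_contra! hall
      choose f hf hfa using hall
      have := hL.eq_top_of_strictMono (f := f)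
        (fun m n hmn => get?_lt (hf m) (hf n) (by omega)) hfa
      exact not_top_lt (this ▸ hab.lt)
    classical
    -- For the first pair not ending by `a`, the gap just before it contains `[a, b)`.
    obtain ⟨i, hi, hmin⟩ : ∃ i, (¬ ∃ e, y.get? (2 * i + 1) = some e ∧ e ≤ a) ∧
        ∀ j < i, ∃ e, y.get? (2 * j + 1) = some e ∧ e ≤ a :=
      ⟨Nat.find hex, Nat.find_spec hex, fun j hj => not_not.1 (Nat.find_min hex hj)⟩
    cases i with
    | zero => exact absurd h0 hi
    | succ i =>
      obtain ⟨c, hc, hca⟩ := hmin i (Nat.lt_succ_self i)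
      push Not at hi
      exact ⟨c, _, hca, hstep (i + 1) hi, Or.inr ⟨i, hc, rfl⟩⟩
  · push Not at h0
    exact ⟨⊥, _, bot_le, hstep 0 h0, Or.inl ⟨rfl, rfl⟩⟩

end

/-! ### Comparability of terms and the orthomodular law. -/

section

variable {L : Type u} [PartialOrder L] {x y : AdmissibleSeq L}

theorem Orthogonal.le_or_le {e f : L} (h : x.Orthogonal y) (he : e ∈ x.terms) (hf : f ∈ y.terms) :
    e ≤ f ∨ f ≤ e := by
  obtain ⟨a, b, hab, he⟩ := mem_terms_iff.1 he
  obtain ⟨c, d, hcd, hf⟩ := mem_terms_iff.1 hf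
  have h1 : a ≤ e ∧ e ≤ b := by
    rcases he with rfl | rfl
    exacts [⟨le_rfl, hab.lt.le⟩, ⟨hab.lt.le, le_rfl⟩]
  have h2 : c ≤ f ∧ f ≤ d := by
    rcases hf with rfl | rfl
    exacts [⟨le_rfl, hcd.lt.le⟩, ⟨hcd.lt.le, le_rfl⟩]
  exact (h a b c d hab hcd).imp (fun h => (h1.2.trans h).trans h2.1)
    fun h => (h2.2.trans h).trans h1.1

/-- A term of `x` lies between the two ends of some pair of `y`, and no term of `y` lies strictly
between these. -/
theorem Below.le_or_le {e f : L} (h : x.Below y) (he : e ∈ x.terms) (hf : f ∈ y.terms) :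
    e ≤ f ∨ f ≤ e := by
  obtain ⟨a, b, hab, he⟩ := mem_terms_iff.1 he
  obtain ⟨c', d', hcd', hca, -, hbd⟩ := h a b hab
  have h1 : c' ≤ e ∧ e ≤ d' := by
    rcases he with rfl | rfl
    exacts [⟨hca, hab.lt.le.trans hbd⟩, ⟨hca.trans hab.lt.le, hbd⟩]
  rcases (isChain_terms y).total hf hcd'.left_mem with h2 | h2
  · exact Or.inr (h2.trans h1.1)
  rcases (isChain_terms y).total hf hcd'.right_mem with h3 | h3
  · obtain ⟨c, d, hcd, hf⟩ := mem_terms_iff.1 hf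
    rcases hcd.eq_or_lt_or_lt hcd' with ⟨rfl, rfl⟩ | h4 | h4
    · rcases hf with rfl | rfl
      exacts [Or.inr h1.1, Or.inl h1.2]
    · refine Or.inr (le_trans ?_ h1.1)
      rcases hf with rfl | rfl
      exacts [hcd.lt.le.trans h4.le, h4.le]
    · refine Or.inl (h1.2.trans ?_)
      rcases hf with rfl | rfl
      exacts [h4.le, h4.le.trans hcd.lt.le]
  · exact Or.inl (h1.2.trans h3)

theorem interval_ne_zero {a b : L} (h : a < b) : interval a b h ≠ zero := fun h0 =>
  not_isPair_zero a b (h0 ▸ (isPair_interval h).2 ⟨rfl, rfl⟩)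

/-- A pair of `y` not contained in a pair of `x` would have a subinterval missing `x`, by
`exists_gap`. Comparability of the terms is essential there. -/
theorem below_of_forall_interval [WellFoundedLT L]
    (hxy : ∀ e ∈ y.terms, ∀ f ∈ x.terms, f ≤ e ∨ e ≤ f)
    (h : ∀ (e f : L) (hef : e < f), (interval e f hef).Below y →
      ¬ (interval e f hef).Orthogonal x) : y.Below x := by
  intro c d hcd
  by_contra hn
  obtain ⟨e, f, hef, hce, hfd, horth⟩ := exists_gap hcd.lt (hxy c hcd.left_mem)
    (hxy d hcd.right_mem) fun ⟨a, b, h1, h2, h3⟩ => hn ⟨a, b, h1, h2, hcd.lt, h3⟩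
  exact h e f hef ((interval_below_iff hef).2 ⟨c, d, hcd, hce, hfd⟩) horth

theorem below_one [BoundedOrder L] [Nontrivial L] (x : AdmissibleSeq L) : x.Below one := fun _ _ h =>
  ⟨⊥, ⊤, (isPair_interval bot_lt_top).2 ⟨rfl, rfl⟩, bot_le, h.lt, le_top⟩

end

section

variable {L : Type u} [Lattice L] [BoundedOrder L] {x y : AdmissibleSeq L}

theorem Below.perp (hL : IsOmegaPlusOneLattice L) (h : x.Below y) : y.perp.Below x.perp :=
  (below_perp_iff hL).2 ((perp_orthogonal y).symm.mono h).symm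

theorem perp_perp (hL : IsOmegaPlusOneLattice L) (x : AdmissibleSeq L) : x.perp.perp = x := by
  have := hL.wellFoundedLT
  refine Below.antisymm (below_of_forall_interval ?_ ?_)
    ((below_perp_iff hL).2 (perp_orthogonal x).symm)
  · intro e he f hf
    rcases terms_perp_subset he with he | rfl | rfl
    · rcases terms_perp_subset he with he | rfl | rfl
      · exact (isChain_terms x).total hf he
      · exact Or.inr bot_le
      · exact Or.inl le_top
    · exact Or.inr bot_le
    · exact Or.inl le_top
  · intro e f hef h1 h2
    have h3 := (below_perp_iff hL).1 h1
    -- An interval inside `x.perp.perp` that misses `x` lies in `x.perp` as well, so it is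
    -- orthogonal to itself.
    have h4 := (below_perp_iff hL).2 h2
    exact interval_ne_zero hef (eq_zero_of_orthogonal_self (h3.symm.mono h4))

theorem eq_zero_of_below_of_below_perp (h : x.Below y) (h' : x.Below y.perp) : x = zero :=
  eq_zero_of_orthogonal_self (((perp_orthogonal y).mono h').symm.mono h)

/-- The orthomodular lattice of admissible sequences of an `(ω + 1)`-lattice. -/
@[reducible]
noncomputable def orthomodularLattice [Nontrivial L] (hL : IsOmegaPlusOneLattice L) :
    OrthomodularLattice (AdmissibleSeq L) :=
  let inf := fun x y : AdmissibleSeq L => Classical.choose (exists_inf hL x y)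
  have hinf : ∀ x y z : AdmissibleSeq L, z.Below (inf x y) ↔ z.Below x ∧ z.Below y :=
    fun x y => (Classical.choose_spec (exists_inf hL x y)).1
  have hperp : ∀ {x y : AdmissibleSeq L}, x.perp.Below y → y.perp.Below x := fun {x y} h => by
    simpa only [perp_perp hL] using h.perp hL
  have hperp' : ∀ {x y : AdmissibleSeq L}, x.Below y.perp → y.Below x.perp := fun {x y} h => by
    simpa only [perp_perp hL] using h.perp hL
  have hsup : ∀ x y z : AdmissibleSeq L,
      (inf x.perp y.perp).perp.Below z ↔ x.Below z ∧ y.Below z := fun x y z =>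
    ⟨fun h => ⟨by simpa only [perp_perp hL] using hperp' ((hinf _ _ _).1 (hperp h)).1,
        by simpa only [perp_perp hL] using hperp' ((hinf _ _ _).1 (hperp h)).2⟩,
      fun h => hperp ((hinf _ _ _).2 ⟨h.1.perp hL, h.2.perp hL⟩)⟩
  have hzero : ∀ {x y : AdmissibleSeq L}, x.Below y → x.Below y.perp → x = zero :=
    fun h h' => eq_zero_of_below_of_below_perp h h'
  have hone : ∀ {x : AdmissibleSeq L}, x.perp = zero → x = one := fun {x} h =>
    (below_one x).antisymm <| by
      have h1 : x.perp.Below one.perp := h ▸ zero_below one.perp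
      have h2 := hperp h1
      rwa [perp_perp hL] at h2
  { le := Below
    le_refl := Below.refl
    le_trans := fun _ _ _ h h' => h.trans h'
    le_antisymm := fun _ _ h h' => h.antisymm h'
    inf := inf
    inf_le_left := fun x y => ((hinf x y _).1 (Below.refl _)).1
    inf_le_right := fun x y => ((hinf x y _).1 (Below.refl _)).2
    le_inf := fun z x y h h' => (hinf x y z).2 ⟨h, h'⟩
    sup := fun x y => (inf x.perp y.perp).perp
    le_sup_left := fun x y => ((hsup x y _).1 (Below.refl _)).1
    le_sup_right := fun x y => ((hsup x y _).1 (Below.refl _)).2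
    sup_le := fun x y z h h' => (hsup x y z).2 ⟨h, h'⟩
    top := one
    bot := zero
    le_top := below_one
    bot_le := zero_below
    compl := perp
    compl_le_compl_of_le := fun _ _ h => h.perp hL
    compl_compl_eq := perp_perp hL
    inf_compl_eq := fun x => hzero ((hinf _ _ _).1 (Below.refl _)).1 ((hinf _ _ _).1 (Below.refl _)).2
    sup_compl_eq := fun x => hone <| by
      have h1 := (hinf x.perp x.perp.perp _).1 (Below.refl _)
      exact (perp_perp hL _).trans (hzero h1.1 h1.2)
    sup_compl_inf_eq_of_le := fun x y hxy => by
      have := hL.wellFoundedLT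
      have h1 := (hinf x.perp y _).1 (Below.refl _)
      have hle : (inf x.perp (inf x.perp y).perp).perp.Below y := (hsup x _ y).2 ⟨hxy, h1.2⟩
      -- An interval below `y` that misses the join lies in `x.perp`, hence in `inf x.perp y`, and
      -- also in the complement of the latter.
      refine hle.antisymm (below_of_forall_interval (fun e he f hf => hle.le_or_le hf he) ?_)
      intro e f hef h2 h3
      have h4 := (below_perp_iff hL).2 h3
      rw [perp_perp hL] at h4
      have h5 := (hinf _ _ _).1 h4
      exact interval_ne_zero hef (hzero ((hinf x.perp y _).2 ⟨h5.1, h2⟩) h5.2) }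

end

end AdmissibleSeq

/-! ### Generalities on ortholattices and chains. -/

section Ortholattice

variable {α : Type u}

theorem le_compl_symm [Ortholattice α] {a b : α} (h : a ≤ bᶜ) : b ≤ aᶜ := by
  have := Ortholattice.compl_le_compl_of_le _ _ h
  rwa [Ortholattice.compl_compl_eq] at this

theorem le_of_compl_le_compl [Ortholattice α] {a b : α} (h : bᶜ ≤ aᶜ) : a ≤ b := by
  have := le_compl_symm h
  rwa [Ortholattice.compl_compl_eq] at this

theorem ortho_compl_sup [Ortholattice α] (a b : α) : (a ⊔ b)ᶜ = aᶜ ⊓ bᶜ :=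
  le_antisymm (le_inf (Ortholattice.compl_le_compl_of_le _ _ le_sup_left)
    (Ortholattice.compl_le_compl_of_le _ _ le_sup_right))
    (le_compl_symm (sup_le (le_compl_symm inf_le_left) (le_compl_symm inf_le_right)))

theorem eq_bot_of_le_of_le_compl [Ortholattice α] {a b : α} (h : a ≤ b) (h' : a ≤ bᶜ) : a = ⊥ :=
  le_bot_iff.1 ((le_inf h h').trans (Ortholattice.inf_compl_eq b).le)

theorem IsOrthoSubalgebra.of_inf_compl [Ortholattice α] {S : Set α} (hbot : ⊥ ∈ S)
    (hinf : ∀ a ∈ S, ∀ b ∈ S, a ⊓ b ∈ S) (hcompl : ∀ a ∈ S, aᶜ ∈ S) : IsOrthoSubalgebra S where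
  bot_mem := hbot
  top_mem := by
    rw [← Ortholattice.sup_compl_eq (⊥ : α), bot_sup_eq]
    exact hcompl _ hbot
  sup_mem a ha b hb := by
    rw [← Ortholattice.compl_compl_eq (a ⊔ b), ortho_compl_sup]
    exact hcompl _ (hinf _ (hcompl a ha) _ (hcompl b hb))
  inf_mem := hinf
  compl_mem := hcompl

/-- The orthomodular law splits `a` into `a ⊓ b` and `a ⊓ (a ⊓ b)ᶜ`. -/
theorem le_of_inf_compl_inf_eq_bot [OrthomodularLattice α] {a b : α} (h : a ⊓ (a ⊓ b)ᶜ = ⊥) :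
    a ≤ b := by
  have := OrthomodularLattice.sup_compl_inf_eq_of_le (a ⊓ b) a inf_le_left
  rw [inf_comm (a ⊓ b)ᶜ, h, sup_bot_eq] at this
  exact inf_eq_left.1 this

/-- In a subalgebra of an orthomodular lattice a covering pair `u < v` yields an atom. -/
theorem eq_bot_or_eq_of_covering [OrthomodularLattice α] {S : Set α} (hS : IsOrthoSubalgebra S)
    {u v : α} (hu : u ∈ S) (huv : u ≤ v) (hcov : ∀ w ∈ S, u ≤ w → w ≤ v → w = u ∨ w = v)
    {a : α} (ha : a ∈ S) (hav : a ≤ uᶜ ⊓ v) : a = ⊥ ∨ a = uᶜ ⊓ v := by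
  rcases hcov (u ⊔ a) (hS.sup_mem u hu a ha) le_sup_left (sup_le huv (hav.trans inf_le_right))
    with h | h
  · exact Or.inl (eq_bot_of_le_of_le_compl (sup_eq_left.1 h) (hav.trans inf_le_left))
  · right
    have h1 := OrthomodularLattice.sup_compl_inf_eq_of_le a _ hav
    rw [← inf_assoc, inf_comm aᶜ, ← ortho_compl_sup, h, inf_comm, Ortholattice.inf_compl_eq,
      sup_bot_eq] at h1
    exact h1

theorem IsBooleanOrthoSubalgebra.eq_inf_sup_inf_compl [Ortholattice α] {S : Set α}
    (hS : IsBooleanOrthoSubalgebra S) {a b : α} (ha : a ∈ S) (hb : b ∈ S) :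
    a = (a ⊓ b) ⊔ (a ⊓ bᶜ) := by
  rw [← hS.2 a ha b hb _ (hS.1.compl_mem b hb), Ortholattice.sup_compl_eq, inf_top_eq]

end Ortholattice

theorem exists_maximal_chain_subset {α : Type u} [PartialOrder α] (s : Set α) :
    ∃ D ⊆ s, IsChain (· ≤ ·) D ∧ ∀ w ∈ s, (∀ d ∈ D, w ≤ d ∨ d ≤ w) → w ∈ D := by
  obtain ⟨M, hM, -⟩ := (IsChain.empty (r := fun a b : s => a ≤ b)).exists_maxChain
  refine ⟨Subtype.val '' M, by rintro _ ⟨d, -, rfl⟩; exact d.2, ?_, fun w hw h => ?_⟩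
  · rintro _ ⟨d, hd, rfl⟩ _ ⟨e, he, rfl⟩ -
    exact hM.1.total hd he
  · have := hM.2 (hM.1.insert (a := ⟨w, hw⟩) fun d hd _ => h d ⟨d, hd, rfl⟩)
      (Set.subset_insert _ _)
    exact ⟨⟨w, hw⟩, this ▸ Set.mem_insert _ _, rfl⟩

theorem IsChain.exists_next {α : Type u} [PartialOrder α] [WellFoundedLT α] {E : Set α}
    (hE : IsChain (· ≤ ·) E) {p q : α} (hp : p ∈ E) (hq : q ∈ E) (hpq : p < q) :
    ∃ r, p < r ∧ r ≤ q ∧ ∀ e ∈ E, e ≤ p ∨ r ≤ e := by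
  obtain ⟨r, ⟨hpr, hr⟩, hmin⟩ := (wellFounded_lt (α := α)).has_min {e | p < e ∧ e ∈ E} ⟨q, hpq, hq⟩
  have key : ∀ e ∈ E, p < e → r ≤ e := fun e he hpe =>
    (hE.total hr he).elim id fun h => (h.eq_or_lt.resolve_right (hmin e ⟨hpe, he⟩)).ge
  refine ⟨r, hpr, key q hq hpq, fun e he => ?_⟩
  rcases hE.total he hp with h | h
  · exact Or.inl h
  · exact h.eq_or_lt.elim (fun h => Or.inl h.ge) fun h => Or.inr (key e he h)

/-! ### Complete hereditary atomicity. -/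

namespace AdmissibleSeq

variable {L : Type u}

/-- With no term of `x` strictly inside it, the interval cannot be split by `x`. This is the sense
in which an interval between neighbours behaves like a point. -/
theorem interval_below_or_orthogonal [PartialOrder L] {x : AdmissibleSeq L} {p r : L} (hpr : p < r)
    (h : ∀ e ∈ x.terms, e ≤ p ∨ r ≤ e) :
    (interval p r hpr).Below x ∨ (interval p r hpr).Orthogonal x := by
  by_contra! hcon
  refine hcon.2 fun a b c d hab hcd => ?_
  obtain ⟨rfl, rfl⟩ := (isPair_interval hpr).1 hab
  by_contra! hn
  exact hcon.1 ((interval_below_iff hpr).2 ⟨c, d, hcd, (h c hcd.left_mem).resolve_right hn.1,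
    (h d hcd.right_mem).resolve_left hn.2⟩)

section

variable [Lattice L] [OrthomodularLattice (AdmissibleSeq L)]

theorem bot_eq_zero (hle : ∀ x y : AdmissibleSeq L, x ≤ y ↔ x.Below y) :
    (⊥ : AdmissibleSeq L) = zero :=
  le_bot_iff.1 ((hle _ _).2 (zero_below _)) |>.symm

variable [BoundedOrder L]

theorem le_compl_iff_orthogonal (hL : IsOmegaPlusOneLattice L)
    (hle : ∀ x y : AdmissibleSeq L, x ≤ y ↔ x.Below y)
    (hcompl : ∀ x : AdmissibleSeq L, xᶜ = x.perp) {x y : AdmissibleSeq L} :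
    x ≤ yᶜ ↔ x.Orthogonal y := by
  rw [hle, hcompl, below_perp_iff hL]

theorem exists_isGLB (hL : IsOmegaPlusOneLattice L)
    (hle : ∀ x y : AdmissibleSeq L, x ≤ y ↔ x.Below y) (T : Set (AdmissibleSeq L)) :
    ∃ a, IsGLB T a := by
  obtain ⟨m, hm, -⟩ := exists_glb hL T
  refine ⟨m, fun y hy => (hle _ _).2 ((hm m).1 (Below.refl m) y hy), fun z hz => ?_⟩
  exact (hle _ _).2 ((hm z).2 fun y hy => (hle _ _).1 (hz hy))

theorem exists_isLUB (hL : IsOmegaPlusOneLattice L)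
    (hle : ∀ x y : AdmissibleSeq L, x ≤ y ↔ x.Below y) (T : Set (AdmissibleSeq L)) :
    ∃ a, IsLUB T a := by
  obtain ⟨a, ha⟩ := exists_isGLB hL hle (upperBounds T)
  exact ⟨a, isGLB_upperBounds.1 ha⟩

theorem isCompletelyHereditarilyAtomic (hL : IsOmegaPlusOneLattice L)
    (hle : ∀ x y : AdmissibleSeq L, x ≤ y ↔ x.Below y)
    (hcompl : ∀ x : AdmissibleSeq L, xᶜ = x.perp) :
    IsCompletelyHereditarilyAtomic (AdmissibleSeq L) := by
  have hwf := hL.wellFoundedLT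
  refine ⟨fun T => ⟨exists_isLUB hL hle T, exists_isGLB hL hle T⟩, fun S hS => ?_⟩
  let := hS.toIsOrthoSubalgebra.orderBot
  refine ⟨fun ⟨x, hx⟩ => or_iff_not_imp_left.2 fun hx0 => ?_⟩
  have hx0' : x ≠ zero := fun h => hx0 (Subtype.ext (h.trans (bot_eq_zero hle).symm))
  obtain ⟨D, hD, hch, hmax⟩ := exists_maximal_chain_subset {y | y ∈ S ∧ y ≤ x}
  have hxD : x ∈ D := hmax x ⟨hx, le_rfl⟩ fun d hd => Or.inr (hD hd).2
  -- Comparable sequences have comparable terms, so the chain `D` yields a chain in `L`, where `p`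
  -- has a successor `r`.
  have hE : IsChain (· ≤ ·) {e | ∃ d ∈ D, e ∈ d.terms} := by
    rintro e ⟨d, hd, he⟩ f ⟨d', hd', hf⟩ -
    rcases hch.total hd hd' with h | h
    · exact ((hle _ _).1 h).le_or_le he hf
    · exact (((hle _ _).1 h).le_or_le hf he).symm
  obtain ⟨p, q, hpq⟩ := exists_isPair_of_ne_zero hx0'
  obtain ⟨r, hpr, hrq, hr⟩ := hE.exists_next ⟨x, hxD, hpq.left_mem⟩ ⟨x, hxD, hpq.right_mem⟩ hpq.lt
  have ht0 : interval p r hpr ≠ ⊥ := (bot_eq_zero hle).symm ▸ interval_ne_zero hpr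
  have htx : interval p r hpr ≤ x :=
    (hle _ _).2 ((interval_below_iff hpr).2 ⟨p, q, hpq, le_rfl, hrq⟩)
  have htD : ∀ d ∈ D, interval p r hpr ≤ d ∨ interval p r hpr ≤ dᶜ := fun d hd => by
    rw [hle, le_compl_iff_orthogonal hL hle hcompl]
    exact interval_below_or_orthogonal hpr fun e he => hr e ⟨d, hd, he⟩
  -- The interval `[p, r)` cuts `D` in two: `v` is the meet of the members containing it, `u` the
  -- join of those orthogonal to it. Nothing in `S` lies strictly between `u` and `v`, by maximality
  -- of `D`, and `uᶜ ⊓ v` contains the interval; so it is an atom of `S`.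
  obtain ⟨v, hv⟩ := exists_isGLB hL hle {d | d ∈ D ∧ interval p r hpr ≤ d}
  obtain ⟨u, hu⟩ := exists_isLUB hL hle {d | d ∈ D ∧ ¬ interval p r hpr ≤ d}
  have hvS : v ∈ S := hS.glb_mem _ (fun d hd => (hD hd.1).1) v hv
  have huS : u ∈ S := hS.lub_mem _ (fun d hd => (hD hd.1).1) u hu
  have hvx : v ≤ x := hv.1 ⟨hxD, htx⟩
  have htv : interval p r hpr ≤ v := hv.2 fun d hd => hd.2
  have hut : u ≤ (interval p r hpr)ᶜ :=
    hu.2 fun d hd => le_compl_symm ((htD d hd.1).resolve_left hd.2)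
  have huv : u ≤ v := hu.2 fun d hd => hv.2 fun e he =>
    (hch.total hd.1 he.1).resolve_right fun h => hd.2 (he.2.trans h)
  have hcov : ∀ w ∈ S, u ≤ w → w ≤ v → w = u ∨ w = v := by
    intro w hw huw hwv
    have hwD : w ∈ D := hmax w ⟨hw, hwv.trans hvx⟩ fun d hd => by
      by_cases h : interval p r hpr ≤ d
      · exact Or.inl (hwv.trans (hv.1 ⟨hd, h⟩))
      · exact Or.inr ((hu.1 ⟨hd, h⟩).trans huw)
    by_cases h : interval p r hpr ≤ w
    · exact Or.inr (le_antisymm hwv (hv.1 ⟨hwD, h⟩))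
    · exact Or.inl (le_antisymm (hu.1 ⟨hwD, h⟩) huw)
  have hmem : uᶜ ⊓ v ∈ S := hS.inf_mem _ (hS.compl_mem u huS) v hvS
  refine ⟨⟨uᶜ ⊓ v, hmem⟩, ⟨fun h => ht0 ?_, fun b hb => ?_⟩, inf_le_right.trans hvx⟩
  · exact le_bot_iff.1 ((le_inf (le_compl_symm hut) htv).trans (congrArg Subtype.val h).le)
  · exact Subtype.ext <| (eq_bot_or_eq_of_covering hS.toIsOrthoSubalgebra huS huv hcov b.2
      hb.le).resolve_right fun h => hb.ne (Subtype.ext h)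

/-! ### The MacNeille completion. -/

/-- The cut of `K(L)` that consists of the elements below `y` and the elements above `y`. -/
def cut (hle : ∀ x y : AdmissibleSeq L, x ≤ y ↔ x.Below y)
    (hcompl : ∀ x : AdmissibleSeq L, xᶜ = x.perp) (y : AdmissibleSeq L) :
    DedekindCut (Kalmbach L) where
  extent := {k | k.toAdmissible ≤ y}
  intent := {k | y ≤ k.toAdmissible}
  upperPolar_extent := by
    ext k
    refine ⟨fun h => ?_, fun h j hj => (hle _ _).1 (le_trans hj h)⟩
    -- An upper bound of the finite sequences below `y` is above each pair of `y`, since a single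
    -- pair is a finite sequence.
    refine (hle _ _).2 (below_iff_forall_interval.2 fun a b hab => ?_)
    exact @h ⟨interval a b hab.lt, trivial⟩
      ((hle _ _).2 (below_iff_forall_interval.1 (Below.refl y) a b hab))
  lowerPolar_intent := by
    ext k
    refine ⟨fun h => ?_, fun h j hj => (hle _ _).1 (le_trans h hj)⟩
    -- Dually, the complements of the pairs of `yᶜ` are finite sequences above `y`.
    refine le_of_compl_le_compl ((hle _ _).2 (below_iff_forall_interval.2 fun a b hab => ?_))
    have hi : interval a b hab.lt ≤ yᶜ :=
      (hle _ _).2 (below_iff_forall_interval.1 (Below.refl yᶜ) a b hab)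
    have h1 : k.toAdmissible.Below (interval a b hab.lt).perp :=
      @h (Kalmbach.perp ⟨interval a b hab.lt, trivial⟩) <| show y ≤ (interval a b hab.lt).perp by
        have := le_compl_symm hi
        rwa [hcompl] at this
    rw [← hle, ← hcompl] at h1
    exact (hle _ _).1 (le_compl_symm h1)

theorem exists_macNeille (hL : IsOmegaPlusOneLattice L)
    (hle : ∀ x y : AdmissibleSeq L, x ≤ y ↔ x.Below y)
    (hcompl : ∀ x : AdmissibleSeq L, xᶜ = x.perp) :
    ∃ e : DedekindCut (Kalmbach L) ≃o AdmissibleSeq L,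
      (∀ x : Kalmbach L, e (DedekindCut.principal x) = x.toAdmissible) ∧
      ∀ A : DedekindCut (Kalmbach L), (e.symm (e A)ᶜ).left = Kalmbach.perp '' A.right := by
  have hcut : ∀ y z : AdmissibleSeq L,
      cut hle hcompl y ≤ cut hle hcompl z ↔ y ≤ z := by
    refine fun y z => ⟨fun h => ?_, fun h k hk => le_trans hk h⟩
    refine (hle _ _).2 (below_iff_forall_interval.2 fun a b hab => (hle _ _).1 ?_)
    exact @h ⟨interval a b hab.lt, trivial⟩
      ((hle _ _).2 (below_iff_forall_interval.1 (Below.refl y) a b hab))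
  have hsurj : Function.Surjective (cut hle hcompl) := by
    intro A
    obtain ⟨y, hy⟩ := exists_isLUB hL hle (Kalmbach.toAdmissible '' A.left)
    refine ⟨y, DedekindCut.ext (Set.Subset.antisymm (fun k hk => ?_) fun k hk => hy.1 ⟨k, hk, rfl⟩)⟩
    rw [← DedekindCut.lowerBounds_right]
    intro r hr
    refine (hle _ _).1 (le_trans (show k.toAdmissible ≤ y from hk) (hy.2 ?_))
    rintro _ ⟨j, hj, rfl⟩
    rw [← DedekindCut.upperBounds_left] at hr
    exact (hle _ _).2 (hr hj)
  let Φ : AdmissibleSeq L ≃o DedekindCut (Kalmbach L) :=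
    RelIso.ofSurjective (OrderEmbedding.ofMapLEIff (cut hle hcompl) hcut) hsurj
  refine ⟨Φ.symm, fun k => ?_, fun A => ?_⟩
  · rw [OrderIso.symm_apply_eq]
    exact DedekindCut.ext (Set.ext fun j => (hle _ _).symm)
  · obtain ⟨y, rfl⟩ := Φ.surjective A
    rw [OrderIso.symm_apply_apply, OrderIso.symm_symm]
    ext k
    constructor
    · intro hk
      refine ⟨k.perp, ?_, Subtype.ext (perp_perp hL _)⟩
      have h1 := le_compl_symm (show k.toAdmissible ≤ yᶜ from hk)
      rwa [hcompl] at h1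
    · rintro ⟨j, hj, rfl⟩
      have h1 := Ortholattice.compl_le_compl_of_le _ _ (show y ≤ j.toAdmissible from hj)
      rwa [hcompl j.toAdmissible] at h1

/-! ### Blocks and maximal chains. -/

theorem inSubset_isOrthoSubalgebra (hL : IsOmegaPlusOneLattice L)
    (hle : ∀ x y : AdmissibleSeq L, x ≤ y ↔ x.Below y)
    (hcompl : ∀ x : AdmissibleSeq L, xᶜ = x.perp) {C : Set L} (hC : IsMaxChain (· ≤ ·) C) :
    IsOrthoSubalgebra (inSubset C) := by
  refine IsOrthoSubalgebra.of_inf_compl ?_ (fun x hx y hy => ?_) fun x hx e he => ?_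
  · intro e he
    obtain ⟨a, b, hab, -⟩ := mem_terms_iff.1 he
    rw [bot_eq_zero hle] at hab
    exact absurd hab (not_isPair_zero a b)
  · obtain ⟨m, hm, hpair⟩ := exists_inf hL x y
    have hxy : x ⊓ y = m := le_antisymm
      ((hle _ _).2 ((hm _).2 ⟨(hle _ _).1 inf_le_left, (hle _ _).1 inf_le_right⟩))
      (le_inf ((hle _ _).2 ((hm m).1 (Below.refl m)).1) ((hle _ _).2 ((hm m).1 (Below.refl m)).2))
    rw [hxy]
    intro e he
    obtain ⟨a, b, hab, he⟩ := mem_terms_iff.1 he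
    -- Ends of pairs of a meet are binary joins and meets in `L` of elements of the chain `C`, so
    -- each is one of the two.
    obtain ⟨p, q, hp, hq, rfl, rfl⟩ := hpair a b hab
    rcases he with rfl | rfl
    · rcases hC.1.total (hx hp.left_mem) (hy hq.left_mem) with h | h
      · rw [sup_eq_right.2 h]
        exact hy hq.left_mem
      · rw [sup_eq_left.2 h]
        exact hx hp.left_mem
    · rcases hC.1.total (hx hp.right_mem) (hy hq.right_mem) with h | h
      · rw [inf_eq_left.2 h]
        exact hx hp.right_mem
      · rw [inf_eq_right.2 h]
        exact hy hq.right_mem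
  · rw [hcompl] at he
    rcases terms_perp_subset he with he | rfl | rfl
    exacts [hx he, hC.bot_mem, hC.top_mem]

theorem inSubset_isBoolean (hL : IsOmegaPlusOneLattice L)
    (hle : ∀ x y : AdmissibleSeq L, x ≤ y ↔ x.Below y)
    (hcompl : ∀ x : AdmissibleSeq L, xᶜ = x.perp) {C : Set L} (hC : IsMaxChain (· ≤ ·) C) :
    IsBooleanOrthoSubalgebra (inSubset C) := by
  have hwf := hL.wellFoundedLT
  have hS := inSubset_isOrthoSubalgebra hL hle hcompl hC
  -- The order on `K*(C)` is detected by nonzero `t` that lie below each member or its complement: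
  -- if `x ≤ y` fails, the interval from a term of `x ⊓ (x ⊓ y)ᶜ` to its successor in `C` is such a
  -- `t`. Distributivity is then checked as for points of sets.
  have key : ∀ x ∈ inSubset C, ∀ y ∈ inSubset C, (∀ t : AdmissibleSeq L,
      (∀ z ∈ inSubset C, t ≤ z ∨ t ≤ zᶜ) → t ≠ ⊥ → t ≤ x → t ≤ y) → x ≤ y := by
    intro x hx y hy h
    refine le_of_inf_compl_inf_eq_bot ?_
    by_contra hne
    rw [bot_eq_zero hle] at hne
    have hmem := hS.inf_mem _ hx _ (hS.compl_mem _ (hS.inf_mem _ hx _ hy))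
    obtain ⟨p, q, hpq⟩ := exists_isPair_of_ne_zero hne
    obtain ⟨r, hpr, hrq, hr⟩ :=
      hC.1.exists_next (hmem hpq.left_mem) (hmem hpq.right_mem) hpq.lt
    have ht0 : interval p r hpr ≠ ⊥ := (bot_eq_zero hle).symm ▸ interval_ne_zero hpr
    have ht := (hle _ _).2 ((interval_below_iff hpr).2 ⟨p, q, hpq, le_rfl, hrq⟩)
    have htx := ht.trans inf_le_left
    refine ht0 (eq_bot_of_le_of_le_compl (le_inf htx (h _ (fun z hz => ?_) ht0 htx))
      (ht.trans inf_le_right))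
    rw [hle, le_compl_iff_orthogonal hL hle hcompl]
    exact interval_below_or_orthogonal hpr fun e he => hr e (hz he)
  refine ⟨hS, fun a ha b hb c hc => le_antisymm (key _ (hS.inf_mem _ ha _ (hS.sup_mem _ hb _ hc)) _
    (hS.sup_mem _ (hS.inf_mem _ ha _ hb) _ (hS.inf_mem _ ha _ hc)) ?_) ?_⟩
  · intro t ht ht0 hle'
    have hta := hle'.trans inf_le_left
    rcases ht b hb with h | h
    · exact (le_inf hta h).trans le_sup_left
    · rcases ht c hc with h' | h'
      · exact (le_inf hta h').trans le_sup_right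
      · refine absurd (eq_bot_of_le_of_le_compl (hle'.trans inf_le_right) ?_) ht0
        rw [ortho_compl_sup]
        exact le_inf h h'
  · exact sup_le (inf_le_inf_left a le_sup_left) (inf_le_inf_left a le_sup_right)

/-- For `x`, `y` in `S`, the pieces `x ⊓ y`, `x ⊓ yᶜ`, `y ⊓ xᶜ` are pairwise orthogonal, so their
terms form one chain. Distributivity recovers `x` and `y` as joins of pieces, and passing to `K*(C)`
for a maximal chain `C` makes their terms comparable. -/
theorem exists_subset_inSubset (hL : IsOmegaPlusOneLattice L)
    (hle : ∀ x y : AdmissibleSeq L, x ≤ y ↔ x.Below y)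
    (hcompl : ∀ x : AdmissibleSeq L, xᶜ = x.perp) {S : Set (AdmissibleSeq L)}
    (hS : IsBooleanOrthoSubalgebra S) :
    ∃ C : Set L, IsMaxChain (· ≤ ·) C ∧ S ⊆ inSubset C := by
  have key : ∀ x ∈ S, ∀ y ∈ S, ∀ e ∈ x.terms, ∀ f ∈ y.terms, e ≤ f ∨ f ≤ e := by
    intro x hx y hy
    have horth : ∀ {a b z : AdmissibleSeq L}, a ≤ z → b ≤ zᶜ → ∀ e ∈ a.terms, ∀ f ∈ b.terms,
        e ≤ f ∨ f ≤ e := fun {a b z} h h' e he f hf => by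
      have h1 := (le_compl_iff_orthogonal hL hle hcompl).1
        (h'.trans (Ortholattice.compl_le_compl_of_le _ _ h))
      exact h1.symm.le_or_le he hf
    have huv := horth (a := x ⊓ y) (b := x ⊓ yᶜ) inf_le_right inf_le_right
    have huw := horth (a := x ⊓ y) (b := y ⊓ xᶜ) inf_le_left inf_le_right
    have hwv := horth (a := y ⊓ xᶜ) (b := x ⊓ yᶜ) inf_le_left inf_le_right
    have hch : IsChain (· ≤ ·)
        ((x ⊓ y).terms ∪ ((x ⊓ yᶜ).terms ∪ (y ⊓ xᶜ).terms)) := by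
      simp only [isChain_union]
      refine ⟨isChain_terms _, ⟨isChain_terms _, isChain_terms _, fun e he f hf _ =>
        (hwv f hf e he).symm⟩, ?_⟩
      rintro e he f (hf | hf) -
      exacts [huv e he f hf, huw e he f hf]
    obtain ⟨C, hC, hsub⟩ := hch.exists_maxChain
    have hCS := inSubset_isOrthoSubalgebra hL hle hcompl hC
    have hu : x ⊓ y ∈ inSubset C := fun e he => hsub (Or.inl he)
    have hv : x ⊓ yᶜ ∈ inSubset C := fun e he => hsub (Or.inr (Or.inl he))
    have hw : y ⊓ xᶜ ∈ inSubset C := fun e he => hsub (Or.inr (Or.inr he))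
    have hxC : x ∈ inSubset C := by
      rw [hS.eq_inf_sup_inf_compl hx hy]
      exact hCS.sup_mem _ hu _ hv
    have hyC : y ∈ inSubset C := by
      rw [hS.eq_inf_sup_inf_compl hy hx, inf_comm y x]
      exact hCS.sup_mem _ hu _ hw
    exact fun e he f hf => hC.1.total (hxC he) (hyC hf)
  have hch : IsChain (· ≤ ·) {e | ∃ x ∈ S, e ∈ x.terms} := by
    rintro e ⟨x, hx, he⟩ f ⟨y, hy, hf⟩ -
    exact key x hx y hy e he f hf
  obtain ⟨C, hC, hsub⟩ := hch.exists_maxChain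
  exact ⟨C, hC, fun x hx e he => hsub ⟨x, hx, he⟩⟩

theorem isBlock_iff (hL : IsOmegaPlusOneLattice L)
    (hle : ∀ x y : AdmissibleSeq L, x ≤ y ↔ x.Below y)
    (hcompl : ∀ x : AdmissibleSeq L, xᶜ = x.perp) (B : Set (AdmissibleSeq L)) :
    IsBlock B ↔ ∃ C : Set L, IsMaxChain (· ≤ ·) C ∧ B = inSubset C := by
  constructor
  · intro hB
    obtain ⟨C, hC, hBC⟩ := exists_subset_inSubset hL hle hcompl hB.1
    exact ⟨C, hC, Set.Subset.antisymm hBC (hB.2 (inSubset_isBoolean hL hle hcompl hC) hBC)⟩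
  · rintro ⟨C, hC, rfl⟩
    refine ⟨inSubset_isBoolean hL hle hcompl hC, fun S hS hCS => ?_⟩
    obtain ⟨C', hC', hSC⟩ := exists_subset_inSubset hL hle hcompl hS
    -- Each `c ≠ ⊤` in `C` is a term of the sequence `c < ⊤`, which belongs to `K*(C)`; so `K*(C)`
    -- recovers `C`.
    have hCC : C ⊆ C' := by
      intro c hc
      by_cases hct : c = ⊤
      · exact hct ▸ hC'.top_mem
      have hlt : c < ⊤ := lt_top_iff_ne_top.2 hct
      have hmem : interval c ⊤ hlt ∈ inSubset C := by
        intro e he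
        obtain ⟨a, b, hab, he⟩ := mem_terms_iff.1 he
        obtain ⟨rfl, rfl⟩ := (isPair_interval hlt).1 hab
        rcases he with rfl | rfl
        exacts [hc, hC.top_mem]
      exact hSC (hCS hmem) ((isPair_interval hlt).2 ⟨rfl, rfl⟩).left_mem
    rw [hC.2 hC'.1 hCC]
    exact hSC

end

end AdmissibleSeq

theorem mainTheorem4 {L : Type u} [Lattice L] [BoundedOrder L] [Nontrivial L]
    (hL : IsOmegaPlusOneLattice L) :
    -- the relation `⊑` and the operation `perp` make `K*(L)` an orthomodular lattice
    ∃ _ : OrthomodularLattice (AdmissibleSeq L),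
      (∀ x y : AdmissibleSeq L, x ≤ y ↔ x.Below y) ∧
      (∀ x : AdmissibleSeq L, xᶜ = x.perp) ∧
      (⊥ : AdmissibleSeq L) = AdmissibleSeq.zero ∧
      (⊤ : AdmissibleSeq L) = AdmissibleSeq.one ∧
      IsCompletelyHereditarilyAtomic (AdmissibleSeq L) ∧
      -- `K*(L)` is the MacNeille completion of `K(L)`, also as an ortholattice
      (∃ e : DedekindCut (Kalmbach L) ≃o AdmissibleSeq L,
        (∀ x : Kalmbach L, e (DedekindCut.principal x) = x.toAdmissible) ∧
        ∀ A : DedekindCut (Kalmbach L), (e.symm (e A)ᶜ).left = Kalmbach.perp '' A.right) ∧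
      -- the blocks of `K*(L)` are the sets `K*(C)` for maximal chains `C` of `L`
      ∀ B : Set (AdmissibleSeq L),
        IsBlock B ↔ ∃ C : Set L, IsMaxChain (· ≤ ·) C ∧ B = AdmissibleSeq.inSubset C := by
  let := AdmissibleSeq.orthomodularLattice hL
  have hle : ∀ x y : AdmissibleSeq L, x ≤ y ↔ x.Below y := fun _ _ => Iff.rfl
  have hcompl : ∀ x : AdmissibleSeq L, xᶜ = x.perp := fun _ => rfl
  exact ⟨this, hle, hcompl, rfl, rfl, AdmissibleSeq.isCompletelyHereditarilyAtomic hL hle hcompl,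
    AdmissibleSeq.exists_macNeille hL hle hcompl, AdmissibleSeq.isBlock_iff hL hle hcompl⟩
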